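/- Let $N\ge1$ and $M\ge0$ be integers, and let $\lambda,\mu$ be partitions with $\lambda'_1+\lambda'_2\le N+M$ and $\mu'_1+\mu'_2\le M$, where $'$ denotes the conjugate partition. Let $\omega=\{(i,j): i\ge1,\ \mu_i<j\le\lambda_i\}$ and let $n$ be its number of boxes. Fill $\omega$ with $1,\dots,n$ by columns from left to right, downwards in every column; this is the column tableau $\Omega$. Let $c_k=j-i$ if $k$ occupies the box $(i,j)$, and put $d_k=c_k+\frac M2-\frac12$. The Yangian $\mathrm Y(\mathfrak{gl}_N)$ is the unital associative $\mathbb C$-algebra with generators $T_{ij}^{(a)}$ ($a\ge1$, $1\le i,j\le N$) and, for $T_{ij}(x)=\delta_{ij}+\sum_{a\ge1}T_{ij}^{(a)}x^{-a}$, the relations $$(x-y)\,[T_{ij}(x),T_{kl}(y)]=T_{kj}(x)T_{il}(y)-T_{kj}(y)T_{il}(x).$$ Its coproduct is $\Delta(T_{ij}(x))=\sum_k T_{ik}(x)\otimes T_{kj}(x)$ and its counit is $T_{ij}(x)\mapsto\delta_{ij}$. The twisted Yangian $\mathrm Y(\mathfrak{gl}_N,\sigma)$ is the subalgebra generated by the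 coefficients of all series $\sum_k T_{ki}(-x)T_{kj}(x)$. Let $\tau_z:T_{ij}(x)\mapsto T_{ij}(x-z)$, let $\alpha_N:\mathrm Y(\mathfrak{gl}_N)\to\mathrm U(\mathfrak{gl}_N)$, $T_{ij}(x)\mapsto\delta_{ij}-E_{ji}x^{-1}$, and let $\sigma$ be the automorphism of $\mathrm U(\mathfrak{gl}_N)$ extending $A\mapsto-A^{t}$. The evaluation module $V(z)$ and the twisted evaluation module $\widetilde V(z)$ are the standard $\mathrm U(\mathfrak{gl}_N)$-module $\mathbb C^N$ pulled back through $\alpha_N\circ\tau_z$ and through $\sigma\circ\alpha_N\circ\tau_{-z}$, respectively. On $(\mathbb C^N)^{\otimes n}$ let $P_{kl}$ exchange the $k$-th and $l$-th tensor factors, and let $Q_{kl}$ act in these two factors as $u\otimes v\mapsto\langle u,v\rangle\sum_i e_i\otimes e_i$, where $\langle e_i,e_j\rangle=\delta_{ij}$. Order the pairs $(k,l)$ with $k<l$ lexicographically. The ordered product $$\prod_{1\le k<l\le n}^{\longrightarrow}\Bigl(1-\frac{P_{kl}}{c_k-c_l+t_k-t_l}\Bigr),$$ as a rational function of complex variables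 $t_1,\dots,t_n$ with the constraints $t_k=t_l$ for $k,l$ in the same column of $\Omega$, is regular at $t_1=\dots=t_n$. Let $E_\Omega$ be its value there, and let $$F_\Omega(M)=\prod_{(k,l)}^{\longrightarrow}\Bigl(1-\frac{Q_{kl}}{c_k+c_l+N+M-1}\Bigr)\cdot E_\Omega ,$$ where the ordered product is over the pairs $k<l$ in different columns of $\Omega$. Then $F_\Omega(M)$ is an intertwiner of $\mathrm Y(\mathfrak{gl}_N,\sigma)$-modules $$\widetilde V(d_1)\otimes\dots\otimes\widetilde V(d_n)\longrightarrow V(d_1)\otimes\dots\otimes V(d_n),$$ where both tensor products of $\mathrm Y(\mathfrak{gl}_N)$-modules, formed through $\Delta$ (and the counit if $n=0$), are restricted to the subalgebra $\mathrm Y(\mathfrak{gl}_N,\sigma)$. -/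

import Mathlib

open scoped TensorProduct

noncomputable section

namespace TwistedYangian

/-! ## The Yangian of `gl_N` -/

section YangianAlgebra

/-- A family `t a i j` (the coefficient at `x ^ (-a)` of a formal series `t_ij(x)` in `x⁻¹`) has
leading terms `t 0 i j = δ_ij` and satisfies
`(x - y) [t_ij(x), t_kl(y)] = t_kj(x) t_il(y) - t_kj(y) t_il(x)`,
written out at `x ^ (-a) y ^ (-b)`; the coefficients at the positive powers of `x` or `y` vanish
on both sides because the leading terms are scalars. -/
structure IsYangianFamily {N : ℕ} {A : Type*} [Ring A] (t : ℕ → Fin N → Fin N → A) : Prop where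
  zero : ∀ i j, t 0 i j = if i = j then 1 else 0
  rel : ∀ (a b : ℕ) (i j k l : Fin N),
    (t (a + 1) i j * t b k l - t b k l * t (a + 1) i j)
      - (t a i j * t (b + 1) k l - t (b + 1) k l * t a i j)
    = t a k j * t b i l - t b k j * t a i l

/-- The free algebra on symbols `(a, i, j)`; the symbol `(a, i, j)` stands for `T_ij^(a+1)`. -/
abbrev FreeGen (N : ℕ) : Type := FreeAlgebra ℂ (ℕ × Fin N × Fin N)

/-- `T_ij^(a)` in the free algebra, with `T_ij^(0) = δ_ij`. -/
def freeT (N : ℕ) : ℕ → Fin N → Fin N → FreeGen N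
  | 0, i, j => if i = j then 1 else 0
  | a + 1, i, j => FreeAlgebra.ι ℂ (a, i, j)

/-- The defining relations of `Y(gl_N)`. -/
inductive YRel (N : ℕ) : FreeGen N → FreeGen N → Prop
  | mk (a b : ℕ) (i j k l : Fin N) : YRel N
      ((freeT N (a + 1) i j * freeT N b k l - freeT N b k l * freeT N (a + 1) i j)
        - (freeT N a i j * freeT N (b + 1) k l - freeT N (b + 1) k l * freeT N a i j))
      (freeT N a k j * freeT N b i l - freeT N b k j * freeT N a i l)

/-- The Yangian `Y(gl_N)`. -/
def Yangian (N : ℕ) : Type := RingQuot (YRel N)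

instance (N : ℕ) : Ring (Yangian N) := inferInstanceAs (Ring (RingQuot (YRel N)))

instance (N : ℕ) : Algebra ℂ (Yangian N) := inferInstanceAs (Algebra ℂ (RingQuot (YRel N)))

/-- The element `T_ij^(a)` of `Y(gl_N)`, with `T_ij^(0) = δ_ij`. -/
def T {N : ℕ} (a : ℕ) (i j : Fin N) : Yangian N := RingQuot.mkAlgHom ℂ (YRel N) (freeT N a i j)

theorem isYangianFamily_T (N : ℕ) : IsYangianFamily (fun a (i j : Fin N) => T a i j) where
  zero i j := by
    simp only [T, freeT]
    split_ifs
    · exact map_one (RingQuot.mkAlgHom ℂ (YRel N))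
    · exact map_zero (RingQuot.mkAlgHom ℂ (YRel N))
  rel a b i j k l := by
    have h := RingQuot.mkAlgHom_rel ℂ (YRel.mk a b i j k l)
    simp only [map_sub, map_mul] at h
    exact h

variable {N : ℕ} {A : Type*} [Ring A] [Algebra ℂ A]

theorem lift_freeT {t : ℕ → Fin N → Fin N → A} (ht : IsYangianFamily t) (a : ℕ) (i j : Fin N) :
    FreeAlgebra.lift ℂ (fun g : ℕ × Fin N × Fin N => t (g.1 + 1) g.2.1 g.2.2) (freeT N a i j)
      = t a i j := by
  cases a with
  | zero => rw [ht.zero]; simp only [freeT]; split_ifs <;> simp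
  | succ a => simp [freeT]

/-- The homomorphism out of `Y(gl_N)` with `T_ij^(a) ↦ t a i j`. -/
def yLift (t : ℕ → Fin N → Fin N → A) (ht : IsYangianFamily t) : Yangian N →ₐ[ℂ] A :=
  RingQuot.liftAlgHom ℂ (s := YRel N)
    ⟨FreeAlgebra.lift ℂ (fun g : ℕ × Fin N × Fin N => t (g.1 + 1) g.2.1 g.2.2), by
      rintro _ _ ⟨a, b, i, j, k, l⟩
      simp only [map_sub, map_mul, lift_freeT ht]
      exact ht.rel a b i j k l⟩

@[simp]
theorem yLift_T (t : ℕ → Fin N → Fin N → A) (ht : IsYangianFamily t) (a : ℕ) (i j : Fin N) :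
    yLift t ht (T a i j) = t a i j := by
  unfold yLift T
  exact (RingQuot.liftAlgHom_mkAlgHom_apply ℂ _ _ _).trans (lift_freeT ht a i j)

end YangianAlgebra

/-! ## Products of Yangian families; the coproduct and the counit -/

section Coproduct

variable {N : ℕ} {R : Type*} [Ring R]

/-- `t_ij(x)` as a power series in the inner variable `v = y⁻¹`. -/
def serY (t : ℕ → Fin N → Fin N → R) (i j : Fin N) : PowerSeries (PowerSeries R) :=
  PowerSeries.C (PowerSeries.mk fun b => t b i j)

/-- `t_ij(x)` as a power series in the outer variable `u = x⁻¹`. -/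
def serX (t : ℕ → Fin N → Fin N → R) (i j : Fin N) : PowerSeries (PowerSeries R) :=
  PowerSeries.mk fun a => PowerSeries.C (t a i j)

/-- The outer variable. -/
def varU (R : Type*) [Ring R] : PowerSeries (PowerSeries R) := PowerSeries.X

/-- The inner variable. -/
def varV (R : Type*) [Ring R] : PowerSeries (PowerSeries R) := PowerSeries.C PowerSeries.X

theorem varU_comm (f : PowerSeries (PowerSeries R)) : varU R * f = f * varU R :=
  PowerSeries.X_mul

theorem varV_comm (f : PowerSeries (PowerSeries R)) : varV R * f = f * varV R := by
  ext a : 1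
  simp only [varV, PowerSeries.coeff_C_mul, PowerSeries.coeff_mul_C, PowerSeries.X_mul]

/-- Coefficients of a double series. -/
def dcoeff (a b : ℕ) (f : PowerSeries (PowerSeries R)) : R :=
  PowerSeries.coeff b (PowerSeries.coeff a f)

theorem dcoeff_ext {f g : PowerSeries (PowerSeries R)} (h : ∀ a b, dcoeff a b f = dcoeff a b g) :
    f = g := by
  ext a b
  exact h a b

@[simp] theorem dcoeff_sub (a b : ℕ) (f g : PowerSeries (PowerSeries R)) :
    dcoeff a b (f - g) = dcoeff a b f - dcoeff a b g := by simp [dcoeff]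

@[simp] theorem dcoeff_XY (t s : ℕ → Fin N → Fin N → R) (a b : ℕ) (i j k l : Fin N) :
    dcoeff a b (serX t i j * serY s k l) = t a i j * s b k l := by
  simp [dcoeff, serX, serY, PowerSeries.coeff_mul_C]

@[simp] theorem dcoeff_YX (t s : ℕ → Fin N → Fin N → R) (a b : ℕ) (i j k l : Fin N) :
    dcoeff a b (serY t i j * serX s k l) = t b i j * s a k l := by
  simp [dcoeff, serX, serY, PowerSeries.coeff_C_mul, PowerSeries.coeff_mul_C]

@[simp] theorem dcoeff_U_succ (a b : ℕ) (f : PowerSeries (PowerSeries R)) :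
    dcoeff (a + 1) b (varU R * f) = dcoeff a b f := by
  simp [dcoeff, varU, PowerSeries.coeff_succ_X_mul]

@[simp] theorem dcoeff_U_zero (b : ℕ) (f : PowerSeries (PowerSeries R)) :
    dcoeff 0 b (varU R * f) = 0 := by
  simp [dcoeff, varU]

@[simp] theorem dcoeff_V_succ (a b : ℕ) (f : PowerSeries (PowerSeries R)) :
    dcoeff a (b + 1) (varV R * f) = dcoeff a b f := by
  simp [dcoeff, varV, PowerSeries.coeff_C_mul, PowerSeries.coeff_succ_X_mul]

@[simp] theorem dcoeff_V_zero (a : ℕ) (f : PowerSeries (PowerSeries R)) :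
    dcoeff a 0 (varV R * f) = 0 := by
  simp [dcoeff, varV, PowerSeries.coeff_C_mul]

/-- The defining relation multiplied by `u v`. -/
def SerRel (t : ℕ → Fin N → Fin N → R) : Prop := ∀ i j k l : Fin N,
  (varV R - varU R) * (serX t i j * serY t k l - serY t k l * serX t i j)
    = varU R * (varV R * (serX t k j * serY t i l - serY t k j * serX t i l))

theorem IsYangianFamily.serRel {t : ℕ → Fin N → Fin N → R} (ht : IsYangianFamily t) :
    SerRel t := by
  intro i j k l
  have h0 : ∀ (i j : Fin N) (r : R), t 0 i j * r = r * t 0 i j := by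
    intro i j r; rw [ht.zero]; split_ifs <;> simp
  apply dcoeff_ext
  intro a b
  rw [sub_mul, dcoeff_sub]
  rcases a with _ | a <;> rcases b with _ | b
  · simp
  · simp [h0]
  · simp [h0]
  · simp only [dcoeff_V_succ, dcoeff_U_succ, dcoeff_sub, dcoeff_XY, dcoeff_YX]
    exact ht.rel a b i j k l

theorem isYangianFamily_of_serRel {t : ℕ → Fin N → Fin N → R}
    (h0 : ∀ i j, t 0 i j = if i = j then 1 else 0) (h : SerRel t) : IsYangianFamily t where
  zero := h0
  rel a b i j k l := by
    have := congrArg (dcoeff (a + 1) (b + 1)) (h i j k l)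
    rw [sub_mul, dcoeff_sub] at this
    simpa only [dcoeff_V_succ, dcoeff_U_succ, dcoeff_sub, dcoeff_XY, dcoeff_YX] using this

/-- The family of coefficients of `∑_k s_ik(x) t_kj(x)`. -/
def mulFamily (s t : ℕ → Fin N → Fin N → R) (a : ℕ) (i j : Fin N) : R :=
  ∑ k : Fin N, ∑ p ∈ Finset.HasAntidiagonal.antidiagonal a, s p.1 i k * t p.2 k j

theorem serX_mulFamily (s t : ℕ → Fin N → Fin N → R) (i j : Fin N) :
    serX (mulFamily s t) i j = ∑ k, serX s i k * serX t k j := by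
  ext a : 1
  simp [serX, mulFamily, PowerSeries.coeff_mul]

theorem serY_mulFamily (s t : ℕ → Fin N → Fin N → R) (i j : Fin N) :
    serY (mulFamily s t) i j = ∑ k, serY s i k * serY t k j := by
  simp only [serY, ← map_mul, ← map_sum]
  congr 1
  ext a
  simp [mulFamily, PowerSeries.coeff_mul]

theorem IsYangianFamily.mul {s t : ℕ → Fin N → Fin N → R} (hs : IsYangianFamily s)
    (ht : IsYangianFamily t)
    (hc : ∀ a b i j k l, s a i j * t b k l = t b k l * s a i j) :
    IsYangianFamily (mulFamily s t) := by
  apply isYangianFamily_of_serRel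
  · intro i j
    simp [mulFamily, hs.zero, ht.zero]
  · intro i j k l
    have hS := hs.serRel
    have hT := ht.serRel
    have hXY : ∀ i j k l, serX t i j * serY s k l = serY s k l * serX t i j := by
      intro i j k l
      apply dcoeff_ext
      intro a b
      simp [hc]
    have hYX : ∀ i j k l, serY t i j * serX s k l = serX s k l * serY t i j := by
      intro i j k l
      apply dcoeff_ext
      intro a b
      simp [hc]
    have e1 : ∀ i j k l,
        serX (mulFamily s t) i j * serY (mulFamily s t) k l
          = ∑ m, ∑ p, serX s i m * serY s k p * (serX t m j * serY t p l) := by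
      intro i j k l
      rw [serX_mulFamily, serY_mulFamily, Finset.sum_mul_sum]
      refine Finset.sum_congr rfl fun m _ => Finset.sum_congr rfl fun p _ => ?_
      rw [mul_assoc, ← mul_assoc (serX t m j), hXY]
      simp only [mul_assoc]
    have e2 : ∀ i j k l,
        serY (mulFamily s t) k l * serX (mulFamily s t) i j
          = ∑ m, ∑ p, serY s k p * serX s i m * (serY t p l * serX t m j) := by
      intro i j k l
      rw [serX_mulFamily, serY_mulFamily, Finset.sum_mul_sum, Finset.sum_comm]
      refine Finset.sum_congr rfl fun m _ => Finset.sum_congr rfl fun p _ => ?_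
      rw [mul_assoc, ← mul_assoc (serY t p l), hYX]
      simp only [mul_assoc]
    have hD : ∀ f, (varV R - varU R) * f = f * (varV R - varU R) := by
      intro f; rw [sub_mul, mul_sub, varU_comm, varV_comm]
    have hW : ∀ f, (varU R * varV R) * f = f * (varU R * varV R) := by
      intro f; rw [mul_assoc, varV_comm, ← mul_assoc, varU_comm, mul_assoc]
    have key : ∀ m p,
        (varV R - varU R) *
          (serX s i m * serY s k p * (serX t m j * serY t p l)
            - serY s k p * serX s i m * (serY t p l * serX t m j))
        = varU R * varV R *
          ((serX s k m * serY s i p * (serX t m j * serY t p l)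
              - serY s k m * serX s i p * (serX t m j * serY t p l))
            + (serY s k p * serX s i m * (serX t p j * serY t m l)
              - serY s k p * serX s i m * (serY t p j * serX t m l))) := by
      intro m p
      have h1 := hS i m k p
      have h2 := hT m j p l
      rw [← mul_assoc] at h1 h2
      have split :
          serX s i m * serY s k p * (serX t m j * serY t p l)
            - serY s k p * serX s i m * (serY t p l * serX t m j)
          = (serX s i m * serY s k p - serY s k p * serX s i m) * (serX t m j * serY t p l)
            + serY s k p * serX s i m *
              (serX t m j * serY t p l - serY t p l * serX t m j) := by
        noncomm_ring
      rw [split, mul_add, ← mul_assoc, h1, ← mul_assoc (varV R - varU R), hD,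
        mul_assoc (serY s k p * serX s i m) (varV R - varU R), h2,
        ← mul_assoc (serY s k p * serX s i m), ← hW]
      noncomm_ring
    rw [e1, e2, e1, e2, ← mul_assoc, ← Finset.sum_sub_distrib, Finset.mul_sum]
    simp_rw [← Finset.sum_sub_distrib, Finset.mul_sum, key]
    simp_rw [← Finset.mul_sum]
    congr 1
    simp only [Finset.sum_add_distrib, Finset.sum_sub_distrib]
    rw [Finset.sum_comm (f := fun m p => serY s k p * serX s i m * (serX t p j * serY t m l)),
      Finset.sum_comm (f := fun m p => serY s k p * serX s i m * (serY t p j * serX t m l))]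
    abel

theorem IsYangianFamily.map {A B : Type*} [Ring A] [Ring B] {t : ℕ → Fin N → Fin N → A}
    (ht : IsYangianFamily t) (f : A →+* B) : IsYangianFamily (fun a i j => f (t a i j)) where
  zero i j := by
    rw [ht.zero]
    split_ifs <;> simp
  rel a b i j k l := by
    simpa only [map_sub, map_mul] using congrArg f (ht.rel a b i j k l)

/-- The coproduct `Δ (T_ij(x)) = ∑_k T_ik(x) ⊗ T_kj(x)`. -/
def coproduct (N : ℕ) : Yangian N →ₐ[ℂ] Yangian N ⊗[ℂ] Yangian N :=
  yLift
    (mulFamily (fun a i j => T a i j ⊗ₜ[ℂ] (1 : Yangian N))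
      (fun a i j => (1 : Yangian N) ⊗ₜ[ℂ] T a i j))
    (((isYangianFamily_T N).map
        (Algebra.TensorProduct.includeLeft : Yangian N →ₐ[ℂ] _ ⊗[ℂ] Yangian N).toRingHom).mul
      ((isYangianFamily_T N).map
        (Algebra.TensorProduct.includeRight : Yangian N →ₐ[ℂ] Yangian N ⊗[ℂ] _).toRingHom)
      (fun a b i j k l => by simp))

theorem coproduct_T (N a : ℕ) (i j : Fin N) :
    coproduct N (T a i j)
      = ∑ k, ∑ p ∈ Finset.HasAntidiagonal.antidiagonal a, T p.1 i k ⊗ₜ[ℂ] T p.2 k j := by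
  have h := fun ht => yLift_T (A := Yangian N ⊗[ℂ] Yangian N)
    (mulFamily (fun a i j => T a i j ⊗ₜ[ℂ] (1 : Yangian N))
      (fun a i j => (1 : Yangian N) ⊗ₜ[ℂ] T a i j)) ht a i j
  refine (h _).trans ?_
  simp [mulFamily]

/-- The counit `ε (T_ij(x)) = δ_ij`. -/
def counit (N : ℕ) : Yangian N →ₐ[ℂ] ℂ :=
  yLift (fun a i j => if a = 0 ∧ i = j then 1 else 0)
    ⟨fun i j => by simp, fun a b i j k l => by
      rcases a with _ | a <;> rcases b with _ | b <;> simp⟩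

end Coproduct

/-! ## Shift automorphisms, evaluation homomorphism, evaluation modules -/

section Evaluation

/-- The coefficients of `T_ij(x - z)`, re-expanded in `x⁻¹` by means of
`(x - z) ^ (-(s+1)) = ∑_a (a choose s) z ^ (a-s) x ^ (-(a+1))`. -/
def shiftFamily {N : ℕ} (z : ℂ) : ℕ → Fin N → Fin N → Yangian N
  | 0, i, j => T 0 i j
  | a + 1, i, j =>
      ∑ s ∈ Finset.range (a + 1), ((a.choose s : ℂ) * z ^ (a - s)) • T (s + 1) i j

theorem isYangianFamily_shift (N : ℕ) (z : ℂ) :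
    IsYangianFamily (shiftFamily (N := N) z) := by
  have hT := isYangianFamily_T N
  have hL : ∀ (a : ℕ) (i j : Fin N), shiftFamily z (a + 1) i j
      = ∑ s ∈ Finset.range (a + 1), ((a.choose s : ℂ) * z ^ (a - s)) • T (s + 1) i j :=
    fun a i j => rfl
  have hS : ∀ (a : ℕ) (i j : Fin N), shiftFamily z (a + 2) i j
      = ∑ s ∈ Finset.range (a + 1), ((a.choose s : ℂ) * z ^ (a - s)) • T (s + 2) i j
        + z • shiftFamily z (a + 1) i j := by
    intro a i j
    rw [hL, hL, Finset.sum_range_succ' _ (a + 1), Finset.smul_sum,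
      Finset.sum_range_succ' (fun s => z • ((a.choose s : ℂ) * z ^ (a - s)) • T (s + 1) i j) a]
    have h1 : ∑ s ∈ Finset.range a,
        z • ((a.choose (s + 1) : ℂ) * z ^ (a - (s + 1))) • (T (s + 1 + 1) i j : Yangian N)
        = ∑ s ∈ Finset.range (a + 1),
          ((a.choose (s + 1) : ℂ) * z ^ (a - s)) • (T (s + 2) i j : Yangian N) := by
      rw [Finset.sum_range_succ]
      simp only [Nat.choose_succ_self, Nat.cast_zero, zero_mul, zero_smul, add_zero]
      refine Finset.sum_congr rfl fun s hs => ?_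
      have hs' : a - s = (a - (s + 1)) + 1 := by
        have := Finset.mem_range.1 hs
        omega
      rw [smul_smul, hs', pow_succ]
      congr 1
      ring
    rw [h1, ← add_assoc, ← Finset.sum_add_distrib]
    congr 1
    · refine Finset.sum_congr rfl fun s _ => ?_
      rw [← add_smul, Nat.choose_succ_succ, Nat.add_sub_add_right]
      push_cast
      congr 1
      ring
    · rw [smul_smul]
      simp [pow_succ, mul_comm]
  have h1 : ∀ i j : Fin N, shiftFamily z 1 i j = T 1 i j := by
    intro i j
    simp [hL]
  have hc : ∀ (i j : Fin N) (r : Yangian N), T 0 i j * r = r * T 0 i j := by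
    intro i j r
    rw [hT.zero]
    split_ifs <;> simp
  refine ⟨hT.zero, fun a b i j k l => ?_⟩
  rcases a with _ | a <;> rcases b with _ | b
  · have hr := hT.rel 0 0 i j k l
    rw [zero_add] at hr
    rw [zero_add, h1, h1]
    exact hr
  · have hr := fun r => hT.rel 0 (r + 1) i j k l
    simp only [hc, sub_self, sub_zero, zero_add] at hr
    rw [zero_add, h1, hL, hL, hL]
    simp only [shiftFamily, hc, sub_self, sub_zero, Finset.sum_mul, Finset.mul_sum,
      ← Finset.sum_sub_distrib, smul_mul_assoc, mul_smul_comm, ← smul_sub, hr]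
  · have hr := fun r => hT.rel (r + 1) 0 i j k l
    simp only [← hc, sub_self, zero_sub, zero_add] at hr
    rw [zero_add, h1, hL a i j, hL a k j, hL a i l]
    simp only [shiftFamily, ← hc, sub_self, zero_sub, Finset.sum_mul, Finset.mul_sum,
      ← Finset.sum_sub_distrib, smul_mul_assoc, mul_smul_comm, ← smul_sub, hr,
      ← Finset.sum_neg_distrib, ← smul_neg]
  · have e : ∀ x y u v : Yangian N,
        ((x + z • u) * v - v * (x + z • u)) - (u * (y + z • v) - (y + z • v) * u)
          = (x * v - v * x) - (u * y - y * u) := by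
      intro x y u v
      simp only [add_mul, mul_add, smul_mul_assoc, mul_smul_comm]
      abel
    have m1 : ∀ (f g : ℕ → Yangian N),
        (∑ s ∈ Finset.range (a + 1), ((a.choose s : ℂ) * z ^ (a - s)) • f s)
            * (∑ r ∈ Finset.range (b + 1), ((b.choose r : ℂ) * z ^ (b - r)) • g r)
          = ∑ s ∈ Finset.range (a + 1), ∑ r ∈ Finset.range (b + 1),
            (((a.choose s : ℂ) * z ^ (a - s)) * ((b.choose r : ℂ) * z ^ (b - r)))
              • (f s * g r) := by
      intro f g
      simp only [Finset.sum_mul_sum, smul_mul_smul_comm]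
    have m2 : ∀ (f g : ℕ → Yangian N),
        (∑ r ∈ Finset.range (b + 1), ((b.choose r : ℂ) * z ^ (b - r)) • g r)
            * (∑ s ∈ Finset.range (a + 1), ((a.choose s : ℂ) * z ^ (a - s)) • f s)
          = ∑ s ∈ Finset.range (a + 1), ∑ r ∈ Finset.range (b + 1),
            (((a.choose s : ℂ) * z ^ (a - s)) * ((b.choose r : ℂ) * z ^ (b - r)))
              • (g r * f s) := by
      intro f g
      rw [Finset.sum_mul_sum, Finset.sum_comm]
      refine Finset.sum_congr rfl fun s _ => Finset.sum_congr rfl fun r _ => ?_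
      rw [smul_mul_smul_comm, mul_comm ((b.choose r : ℂ) * z ^ (b - r))]
    rw [hS a i j, hS b k l, e, hL a i j, hL b k l, hL a k j, hL b i l, hL b k j, hL a i l]
    simp only [m1, m2, ← Finset.sum_sub_distrib, ← smul_sub]
    refine Finset.sum_congr rfl fun s _ => Finset.sum_congr rfl fun r _ => ?_
    rw [hT.rel (s + 1) (r + 1) i j k l]

/-- The automorphism `τ_z : T_ij(x) ↦ T_ij(x - z)` of `Y(gl_N)`, as a homomorphism. -/
def tau (N : ℕ) (z : ℂ) : Yangian N →ₐ[ℂ] Yangian N :=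
  yLift (shiftFamily z) (isYangianFamily_shift N z)

/-- The space `ℂ^N`. -/
abbrev Vec (N : ℕ) : Type := Fin N → ℂ

/-- The Lie algebra `gl_N` over `ℂ`. -/
abbrev gl (N : ℕ) : Type := Matrix (Fin N) (Fin N) ℂ

/-- The commutator bracket on `gl_N`. -/
abbrev glLieRing (N : ℕ) : LieRing (gl N) := LieRing.ofAssociativeRing

/-- The commutator bracket on `U(gl_N)`. -/
abbrev uglLieRing (N : ℕ) :
    LieRing (@UniversalEnvelopingAlgebra ℂ (gl N) _ (glLieRing N) _) :=
  LieRing.ofAssociativeRing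

section LieStructure

attribute [local instance 100] glLieRing uglLieRing

/-- The universal enveloping algebra `U(gl_N)`. -/
abbrev Ugl (N : ℕ) : Type := UniversalEnvelopingAlgebra ℂ (gl N)

/-- The matrix unit `E_ij` as an element of `U(gl_N)`. -/
def uE {N : ℕ} (i j : Fin N) : Ugl N :=
  UniversalEnvelopingAlgebra.ι ℂ (Matrix.single i j (1 : ℂ) : gl N)

/-- The coefficients of `δ_ij - E_ji x⁻¹`. -/
def evalFamily {N : ℕ} : ℕ → Fin N → Fin N → Ugl N
  | 0, i, j => if i = j then 1 else 0
  | 1, i, j => - uE j i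
  | _ + 2, _, _ => 0

theorem uE_comm {N : ℕ} (i j k l : Fin N) :
    uE i j * uE k l - uE k l * uE i j
      = (if j = k then uE i l else 0) - (if l = i then uE k j else 0) := by
  have h := (UniversalEnvelopingAlgebra.ι ℂ (L := gl N)).map_lie
    (Matrix.single i j (1 : ℂ)) (Matrix.single k l (1 : ℂ))
  rw [LieRing.of_associative_ring_bracket, LieRing.of_associative_ring_bracket] at h
  refine h.symm.trans ?_
  rw [map_sub]
  congr 1
  · split_ifs with hjk
    · subst hjk; simp [uE]
    · rw [Matrix.single_mul_single_of_ne _ _ _ _ hjk, map_zero]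
  · split_ifs with hli
    · subst hli; simp [uE]
    · rw [Matrix.single_mul_single_of_ne _ _ _ _ hli, map_zero]

theorem isYangianFamily_eval (N : ℕ) : IsYangianFamily (evalFamily (N := N)) := by
  refine ⟨fun i j => rfl, fun a b i j k l => ?_⟩
  rcases a with _ | _ | a <;> rcases b with _ | _ | b
  · simp only [evalFamily]
    split_ifs <;> simp
  · simp only [evalFamily, neg_mul_neg, uE_comm]
    simp only [mul_zero, zero_mul, sub_zero, sub_self]
    by_cases h1 : i = l <;> by_cases h2 : k = j <;>
      simp [h1, h2, sub_eq_add_neg, add_comm]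
  · simp [evalFamily]
  · simp only [evalFamily, neg_mul_neg, uE_comm]
    simp only [mul_zero, zero_mul, zero_sub, sub_self]
    by_cases h1 : i = l <;> by_cases h2 : k = j <;>
      simp [h1, h2, sub_eq_add_neg, add_comm]
  · simp [evalFamily]
  · simp [evalFamily]
  · simp [evalFamily]
  · simp [evalFamily]
  · simp [evalFamily]

/-- The evaluation homomorphism `α_N : T_ij(x) ↦ δ_ij - E_ji x⁻¹`. -/
def alpha (N : ℕ) : Yangian N →ₐ[ℂ] Ugl N := yLift evalFamily (isYangianFamily_eval N)

/-- The involutive automorphism `σ (A) = -Aᵀ` of the Lie algebra `gl_N`. -/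
def sigmaLie (N : ℕ) : gl N →ₗ⁅ℂ⁆ gl N where
  toFun A := -A.transpose
  map_add' A B := by simp [add_comm]
  map_smul' c A := by simp
  map_lie' {A B} := by
    simp only [LieRing.of_associative_ring_bracket, Matrix.transpose_sub, Matrix.transpose_mul]
    noncomm_ring

/-- The extension of `σ` to `U(gl_N)`. -/
def sigma (N : ℕ) : Ugl N →ₐ[ℂ] Ugl N :=
  UniversalEnvelopingAlgebra.lift ℂ ((UniversalEnvelopingAlgebra.ι ℂ).comp (sigmaLie N))

/-- The standard action of `U(gl_N)` on `ℂ^N`. -/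
def stdRep (N : ℕ) : Ugl N →ₐ[ℂ] Module.End ℂ (Vec N) :=
  UniversalEnvelopingAlgebra.lift ℂ (Matrix.toLinAlgEquiv' (R := ℂ) (n := Fin N)).toAlgHom.toLieHom

end LieStructure

/-- The evaluation module `V(z)`: the standard action on `ℂ^N` pulled back through `α_N ∘ τ_z`. -/
def evalRep (N : ℕ) (z : ℂ) : Yangian N →ₐ[ℂ] Module.End ℂ (Vec N) :=
  (stdRep N).comp ((alpha N).comp (tau N z))

/-- The twisted evaluation module `Ṽ(z)`: the standard action on `ℂ^N` pulled back through
`σ ∘ α_N ∘ τ_{-z}`. -/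
def twistedEvalRep (N : ℕ) (z : ℂ) : Yangian N →ₐ[ℂ] Module.End ℂ (Vec N) :=
  (stdRep N).comp ((sigma N).comp ((alpha N).comp (tau N (-z))))

end Evaluation

/-! ## Tensor products of modules; the twisted Yangian -/

section TensorModules

/-- The tensor product of two `Y(gl_N)`-modules, through the coproduct. -/
def tensorRep {N : ℕ} {V W : Type*} [AddCommGroup V] [Module ℂ V] [AddCommGroup W] [Module ℂ W]
    (ρ : Yangian N →ₐ[ℂ] Module.End ℂ V) (θ : Yangian N →ₐ[ℂ] Module.End ℂ W) :
    Yangian N →ₐ[ℂ] Module.End ℂ (V ⊗[ℂ] W) :=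
  (Module.endTensorEndAlgHom (R := ℂ) (S := ℂ) (A := ℂ) (M := V) (N := W)).comp
    ((Algebra.TensorProduct.map ρ θ).comp (coproduct N))

/-- The space `(ℂ^N)^{⊗ n}`. -/
abbrev Tens (N n : ℕ) : Type := PiTensorProduct ℂ (fun _ : Fin n => Vec N)

/-- The identification `(ℂ^N)^{⊗ n} ⊗ ℂ^N = (ℂ^N)^{⊗ (n+1)}`. -/
def tensSucc (N n : ℕ) : Tens N n ⊗[ℂ] Vec N ≃ₗ[ℂ] Tens N (n + 1) :=
  (TensorProduct.congr (LinearEquiv.refl ℂ (Tens N n))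
    (PiTensorProduct.subsingletonEquiv (R := ℂ) (s := fun _ : Fin 1 => Vec N) 0).symm).trans
    (TensorPower.mulEquiv (R := ℂ) (M := Vec N) (n := n) (m := 1))

/-- The tensor product `V_1 ⊗ … ⊗ V_n` of `Y(gl_N)`-modules whose underlying spaces are `ℂ^N`;
for `n = 0` this is the trivial module given by the counit. -/
def tensorPowerRep (N : ℕ) : (n : ℕ) → (Fin n → (Yangian N →ₐ[ℂ] Module.End ℂ (Vec N))) →
    (Yangian N →ₐ[ℂ] Module.End ℂ (Tens N n))
  | 0, _ => (Algebra.ofId ℂ (Module.End ℂ (Tens N 0))).comp (counit N)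
  | n + 1, ρ =>
      ((tensSucc N n).conjAlgEquiv ℂ).toAlgHom.comp
        (tensorRep (tensorPowerRep N n fun k => ρ k.castSucc) (ρ (Fin.last n)))

/-- The coefficient at `x ^ (-a)` of `∑_k T_ki(-x) T_kj(x)`. -/
def twistedGen {N : ℕ} (a : ℕ) (i j : Fin N) : Yangian N :=
  ∑ k : Fin N, ∑ p ∈ Finset.HasAntidiagonal.antidiagonal a, ((-1 : ℂ) ^ p.1) • (T p.1 k i * T p.2 k j)

/-- The twisted Yangian `Y(gl_N, σ)` as a subalgebra of `Y(gl_N)`. -/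
def twistedYangian (N : ℕ) : Subalgebra ℂ (Yangian N) :=
  Algebra.adjoin ℂ {y | ∃ (a : ℕ) (i j : Fin N), y = twistedGen a i j}

/-- `F` is an intertwiner, from the restriction of `ρ` to the restriction of `θ`, of modules over
the twisted Yangian. -/
def IsTwistedIntertwiner {N : ℕ} {V W : Type*} [AddCommGroup V] [Module ℂ V]
    [AddCommGroup W] [Module ℂ W]
    (ρ : Yangian N →ₐ[ℂ] Module.End ℂ V) (θ : Yangian N →ₐ[ℂ] Module.End ℂ W)
    (F : V →ₗ[ℂ] W) : Prop :=
  ∀ y ∈ twistedYangian N, F ∘ₗ ρ y = θ y ∘ₗ F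

end TensorModules

/-! ## The column tableau of a skew diagram -/

section Tableau

/-- The boxes of the skew diagram `{(i, j) : μ_i < j ≤ λ_i}`, each written as (column, row) and
ordered lexicographically, that is, by columns from left to right and downwards in each column.
Rows and columns are counted from `0`. -/
def skewBoxes (la mu : YoungDiagram) : Finset (ℕ ×ₗ ℕ) :=
  (la.cells \ mu.cells).image fun c => toLex (c.2, c.1)

/-- The number of boxes. -/
def size (la mu : YoungDiagram) : ℕ := (skewBoxes la mu).card

/-- The box filled with `k` in the column tableau. -/
def box (la mu : YoungDiagram) : Fin (size la mu) ↪o ℕ ×ₗ ℕ :=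
  (skewBoxes la mu).orderEmbOfFin rfl

/-- The column of the box filled with `k`. -/
def col (la mu : YoungDiagram) (k : Fin (size la mu)) : ℕ := (ofLex (box la mu k)).1

/-- The row of the box filled with `k`. -/
def row (la mu : YoungDiagram) (k : Fin (size la mu)) : ℕ := (ofLex (box la mu k)).2

/-- The content `c_k` (column minus row) of the box filled with `k`. -/
def content (la mu : YoungDiagram) (k : Fin (size la mu)) : ℂ :=
  (col la mu k : ℂ) - (row la mu k : ℂ)

end Tableau

/-! ## The operators `E_Ω` and `F_Ω(M)` -/

section Operators

/-- `P_kl`: exchange of the `k`-th and `l`-th tensor factors. -/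
def P (N : ℕ) {n : ℕ} (k l : Fin n) : Module.End ℂ (Tens N n) :=
  (PiTensorProduct.reindex ℂ (fun _ : Fin n => Vec N) (Equiv.swap k l)).toLinearMap

/-- The operator `A` acting in the `k`-th tensor factor. -/
def site (N : ℕ) {n : ℕ} (k : Fin n) (A : Module.End ℂ (Vec N)) : Module.End ℂ (Tens N n) :=
  PiTensorProduct.map (Function.update (fun _ : Fin n => LinearMap.id) k A)

/-- `Q_kl`: the operator `u ⊗ v ↦ ⟨u, v⟩ ∑_i e_i ⊗ e_i = ∑_{i,j} E_ij u ⊗ E_ij v` acting in the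
`k`-th and `l`-th tensor factors. -/
def Q (N : ℕ) {n : ℕ} (k l : Fin n) : Module.End ℂ (Tens N n) :=
  ∑ i : Fin N, ∑ j : Fin N,
    site N k (Matrix.toLin' (Matrix.single i j 1)) * site N l (Matrix.toLin' (Matrix.single i j 1))

/-- The pairs `(k, l)` with `k < l`, in lexicographic order. -/
def pairs (n : ℕ) : List (Fin n × Fin n) :=
  (List.finRange n ×ˢ List.finRange n).filter fun p => p.1 < p.2

/-- The ordered product of the factors `1 - P_kl / (c_k - c_l + t_k - t_l)` over `k < l`, the
leftmost factor coming from the first pair. -/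
def fusionProduct (la mu : YoungDiagram) (N : ℕ) (t : Fin (size la mu) → ℂ) :
    Module.End ℂ (Tens N (size la mu)) :=
  ((pairs (size la mu)).map fun p =>
    1 - (content la mu p.1 - content la mu p.2 + t p.1 - t p.2)⁻¹ • P N p.1 p.2).prod

/-- The points with `t_k = t_l` whenever `k` and `l` are in the same column of the tableau, and at
which no denominator of the product vanishes. -/
def fusionDomain (la mu : YoungDiagram) : Set (Fin (size la mu) → ℂ) :=
  {t | (∀ k l, col la mu k = col la mu l → t k = t l) ∧
    ∀ k l, k < l → content la mu k - content la mu l + t k - t l ≠ 0}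

/-- The product, as a rational operator-valued function of the constrained variables, is regular
at `t_1 = … = t_n` with the value `E` there: all its matrix elements have the matrix elements of
`E` as limits. As the product depends only on the differences `t_k - t_l`, it is enough to look at
the point `0`; and a rational function of complex variables with a finite limit at a point is
regular there. -/
def IsFusionValue (la mu : YoungDiagram) (N : ℕ) (E : Module.End ℂ (Tens N (size la mu))) : Prop :=
  ∀ (w : Tens N (size la mu)) (φ : Module.Dual ℂ (Tens N (size la mu))),
    Filter.Tendsto (fun t => φ (fusionProduct la mu N t w))
      (nhdsWithin 0 (fusionDomain la mu)) (nhds (φ (E w)))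

open Classical in
/-- The operator `E_Ω`, the value of the product at `t_1 = … = t_n`. -/
def EOp (la mu : YoungDiagram) (N : ℕ) : Module.End ℂ (Tens N (size la mu)) :=
  if h : ∃ E, IsFusionValue la mu N E then h.choose else 0

/-- The operator `F_Ω(M)`: the ordered product of `1 - Q_kl / (c_k + c_l + N + M - 1)` over all
pairs `k < l` in different columns of the tableau, multiplied by `E_Ω` on the right. -/
def FOp (la mu : YoungDiagram) (N M : ℕ) : Module.End ℂ (Tens N (size la mu)) :=
  (((pairs (size la mu)).filter fun p => col la mu p.1 ≠ col la mu p.2).map fun p =>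
    1 - (content la mu p.1 + content la mu p.2 + N + M - 1)⁻¹ • Q N p.1 p.2).prod * EOp la mu N

/-- `d_k = c_k + M/2 - 1/2`. -/
def dParam (la mu : YoungDiagram) (M : ℕ) (k : Fin (size la mu)) : ℂ :=
  content la mu k + (M : ℂ) / 2 - 1 / 2

end Operators

end TwistedYangian

end

/-! Adjoin an auxiliary factor 0 and put R_k = 1 - P_{0k}/(x - d_k) and S_k = 1 + Q_{0k}/(x + d_k).
The matrix of series T(x) acts on the tensor product of the V(d_k) as R_1 ... R_n and on that of the
twisted modules as S_1 ... S_n. Transposition in the auxiliary factor together with x -> -x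
exchanges R_k with S_k and reverses the order. Hence the generating matrix of the twisted Yangian
acts as R_n ... R_1 S_1 ... S_n on the source and as S_n ... S_1 R_1 ... R_n on the target, and F
has to carry the first into the second.

For generic d_k this holds for F = G E, where E and G are the ordered products over all pairs of 1 -
P_kl/(d_k - d_l) and 1 - Q_kl/(d_k + d_l + N). Three kinds of Yang-Baxter relation give E R_n...R_1
= R_1...R_n E, E S_1...S_n = S_n...S_1 E and G R_1...R_n S_n...S_1 = S_n...S_1 R_1...R_n G, and
these combine into `reflection_intertwining`.

The actual parameters are not generic: denominators of E vanish for boxes on one diagonal, and G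
contains pairs in one column, whose denominators may vanish too. Antisymmetry settles both. Down a
column the parameter drops by 1, so E changes sign under exchanges of neighbours in a column
(`colAnti_nestedProd_swapFactor`). This sign lets each singular factor merge with the one before it
into a regular expression (`exists_tendsto_nestedProd_swapFactor`). The sign survives multiplication
by the reduced G, and a contraction kills antisymmetric vectors, so the same-column factors of G act
as 1 (`nestedProd_contrFactor_mul`).

With these factors gone, every remaining denominator of G is nonzero at the limit, by the bound on
the first two columns of the outer diagram. The intertwining relation then passes to the limit along
a line of generic parameters (`embed_FOp_mul`), and its matrix elements in the auxiliary factor are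
the claim for the generators of the twisted Yangian. -/

open scoped TensorProduct

noncomputable section

namespace TwistedYangian

/-! ## Three-factor identities -/

section ThreeFactor

variable {K B : Type*} [CommRing K] [Ring B] [Algebra K B]

/-- The cubic terms agree and the quadratic ones collapse to x z and z x. The scalar condition is
solved by a = 1/u, b = 1/(u+v), c = 1/v. -/
theorem yangBaxter_of_braid {x y z : B} {a b c : K} (hxy : x * y = z * x) (hyz : y * z = z * x)
    (hyx : y * x = x * z) (hzy : z * y = x * z) (h : a * c = a * b + b * c) :
    (1 - a • x) * (1 - b • y) * (1 - c • z) = (1 - c • z) * (1 - b • y) * (1 - a • x) := by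
  have h3 : x * y * z = z * y * x := by rw [hxy, mul_assoc, mul_assoc, hyx]
  simp only [sub_mul, mul_sub, smul_mul_assoc, mul_smul_comm, one_mul, mul_one, h3]
  rw [hxy, hyz, hyx, hzy]
  linear_combination (norm := module) h • (x * z - z * x)

/-- For invertible scalars the condition reads a⁻¹ + b⁻¹ + c⁻¹ = ν, with ν the value of a closed
loop. This is where the shift by N in the denominators of the contractions comes from. -/
theorem yangBaxter_of_contraction_swap_contraction {x y z : B} {a b c ν : K} (hxy : x * y = y * z)
    (hxz : x * z = y * z) (hzy : z * y = y * x) (hzx : z * x = y * x) (hxx : x * x = ν • x)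
    (hzz : z * z = ν • z) (h : a * b + a * c + b * c = a * b * c * ν) :
    (1 - a • x) * (1 - b • y) * (1 - c • z) = (1 - c • z) * (1 - b • y) * (1 - a • x) := by
  have h3 : x * y * z = ν • (y * z) := by rw [hxy, mul_assoc, hzz, mul_smul_comm]
  have h4 : z * y * x = ν • (y * x) := by rw [hzy, mul_assoc, hxx, mul_smul_comm]
  simp only [sub_mul, mul_sub, smul_mul_assoc, mul_smul_comm, one_mul, mul_one, h3, h4]
  rw [hxy, hxz, hzy, hzx]
  linear_combination (norm := module) h • (y * z - y * x)

/-- For invertible scalars the condition reads a⁻¹ = b⁻¹ + c⁻¹; both cubic terms reduce to x. -/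
theorem yangBaxter_of_contraction_contraction_swap {x y z : B} {a b c : K} (hxy : x * y = x * z)
    (hyz : y * z = z * x) (hyx : y * x = z * x) (hzy : z * y = x * z) (hzz : z * z = 1)
    (h : a * b + a * c = b * c) :
    (1 - a • x) * (1 - b • y) * (1 - c • z) = (1 - c • z) * (1 - b • y) * (1 - a • x) := by
  have h3 : x * y * z = x := by rw [hxy, mul_assoc, hzz, mul_one]
  have h4 : z * y * x = x := by rw [mul_assoc, hyx, ← mul_assoc, hzz, one_mul]
  simp only [sub_mul, mul_sub, smul_mul_assoc, mul_smul_comm, one_mul, mul_one, h3, h4]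
  rw [hxy, hyz, hyx, hzy]
  linear_combination (norm := module) h • (x * z - z * x)

end ThreeFactor

/-! ## Ordered products over pairs of a list -/

section NestedProd

variable {X B : Type*} [Monoid B]

/-- The product of `f k l` over the pairs `k` before `l` in a list, in lexicographic order. -/
def nestedProd (f : X → X → B) : List X → B
  | [] => 1
  | k :: L => (L.map (f k)).prod * nestedProd f L

theorem commute_prod_map {R : X → B} {x : B} {L : List X} (h : ∀ l ∈ L, Commute x (R l)) :
    Commute x (L.map R).prod :=
  Commute.list_prod_right _ _ (by simpa using h)

theorem commute_nestedProd {f : X → X → B} {x : B} :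
    ∀ {L : List X}, L.Nodup → (∀ k ∈ L, ∀ l ∈ L, k ≠ l → Commute x (f k l)) →
      Commute x (nestedProd f L)
  | [], _, _ => Commute.one_right x
  | k :: L, hL, h => by
    rw [List.nodup_cons] at hL
    refine Commute.mul_right (commute_prod_map fun l hl => h k (by simp) l (by simp [hl]) ?_)
      (commute_nestedProd hL.2 fun a ha b hb => h a (by simp [ha]) b (by simp [hb]))
    rintro rfl
    exact hL.1 hl

/-- Factors with different indices commute, so the two rows can be interleaved, and `s` passes one
pair `R l * r l` at a time. -/
theorem row_mul_row_mul {R r : X → B} {s : B} :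
    ∀ {L : List X}, L.Nodup → (∀ l ∈ L, R l * r l * s = s * r l * R l) →
      (∀ l ∈ L, ∀ m ∈ L, l ≠ m → Commute (R l) (r m)) →
      (L.map R).prod * (L.map r).prod * s = s * (L.map r).prod * (L.map R).prod
  | [], _, _, _ => by simp
  | l :: L, hL, h, hc => by
    rw [List.nodup_cons] at hL
    have ih := row_mul_row_mul hL.2 (fun m hm => h m (by simp [hm]))
      (fun a ha b hb => hc a (by simp [ha]) b (by simp [hb]))
    have hne : ∀ m ∈ L, l ≠ m := by rintro m hm rfl; exact hL.1 hm
    have c1 : Commute (r l) (L.map R).prod :=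
      commute_prod_map fun m hm => (hc m (by simp [hm]) l (by simp) (hne m hm).symm).symm
    have c2 : Commute (R l) (L.map r).prod :=
      commute_prod_map fun m hm => hc l (by simp) m (by simp [hm]) (hne m hm)
    simp only [List.map_cons, List.prod_cons]
    generalize (L.map R).prod = A at *
    generalize (L.map r).prod = C at *
    calc R l * A * (r l * C) * s = R l * (A * r l) * C * s := by simp only [mul_assoc]
      _ = R l * r l * (A * C * s) := by rw [← c1.eq]; simp only [mul_assoc]
      _ = (R l * r l * s) * C * A := by rw [ih]; simp only [mul_assoc]
      _ = s * r l * (R l * C) * A := by rw [h l (by simp)]; simp only [mul_assoc]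
      _ = s * (r l * C) * (R l * A) := by rw [c2.eq]; simp only [mul_assoc]

/-- Here `s` stays in the middle and the pairs are exchanged from the inside outwards, which is why
the second row runs in the reverse order. -/
theorem row_mul_mul_reverse {R q : X → B} {s : B} :
    ∀ {L : List X}, L.Nodup → (∀ l ∈ L, R l * s * q l = q l * s * R l) →
      (∀ l ∈ L, ∀ m ∈ L, l ≠ m → Commute (R l) (q m)) →
      (L.map R).prod * s * (L.reverse.map q).prod = (L.reverse.map q).prod * s * (L.map R).prod
  | [], _, _, _ => by simp
  | l :: L, hL, h, hc => by
    rw [List.nodup_cons] at hL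
    have ih := row_mul_mul_reverse hL.2 (fun m hm => h m (by simp [hm]))
      (fun a ha b hb => hc a (by simp [ha]) b (by simp [hb]))
    have hne : ∀ m ∈ L, l ≠ m := by rintro m hm rfl; exact hL.1 hm
    have c1 : Commute (q l) (L.map R).prod :=
      commute_prod_map fun m hm => (hc m (by simp [hm]) l (by simp) (hne m hm).symm).symm
    have c2 : Commute (R l) (L.reverse.map q).prod :=
      commute_prod_map fun m hm => hc l (by simp) m (by simp at hm; simp [hm])
        (hne m (by simpa using hm))
    simp only [List.map_cons, List.prod_cons, List.reverse_cons, List.map_append, List.prod_append,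
      List.map_nil, List.prod_nil, mul_one]
    generalize (L.map R).prod = A at *
    generalize (L.reverse.map q).prod = C at *
    calc R l * A * s * (C * q l) = R l * (A * s * C) * q l := by simp only [mul_assoc]
      _ = R l * C * s * (A * q l) := by rw [ih]; simp only [mul_assoc]
      _ = C * (R l * s * q l) * A := by rw [c2.eq, ← c1.eq]; simp only [mul_assoc]
      _ = C * q l * s * (R l * A) := by rw [h l (by simp)]; simp only [mul_assoc]

/-- Carries a row of auxiliary factors through a product over all pairs, one row of pairs per
induction step. It will be used for the swap factors in E with the auxiliary swaps. -/
theorem nestedProd_mul_reverse {R : X → X → B} {r : X → B}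
    (h : ∀ k l, k ≠ l → R k l * r l * r k = r k * r l * R k l)
    (hc : ∀ k l m, k ≠ l → k ≠ m → l ≠ m → Commute (R k l) (r m)) :
    ∀ {L : List X}, L.Nodup →
      nestedProd R L * (L.reverse.map r).prod = (L.map r).prod * nestedProd R L
  | [], _ => by simp [nestedProd]
  | k :: L, hL => by
    rw [List.nodup_cons] at hL
    have hne : ∀ m ∈ L, k ≠ m := by rintro m hm rfl; exact hL.1 hm
    have ih := nestedProd_mul_reverse h hc hL.2
    have h1 := row_mul_row_mul (R := R k) (r := r) (s := r k) hL.2 (fun l hl => h k l (hne l hl))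
      (fun l hl m hm hlm => hc k l m (hne l hl) (hne m hm) hlm)
    have c : Commute (r k) (nestedProd R L) := commute_nestedProd hL.2 fun l hl m hm hlm =>
      (hc l m k hlm (hne l hl).symm (hne m hm).symm).symm
    simp only [nestedProd, List.reverse_cons, List.map_append, List.prod_append, List.map_cons,
      List.map_nil, List.prod_cons, List.prod_nil, mul_one]
    generalize (L.map (R k)).prod = A at *
    generalize (L.map r).prod = C at *
    generalize nestedProd R L = D at *
    calc A * D * ((L.reverse.map r).prod * r k) = A * (D * (L.reverse.map r).prod) * r k := by
          simp only [mul_assoc]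
      _ = A * C * (r k * D) := by rw [ih, c.eq]; simp only [mul_assoc]
      _ = A * C * r k * D := by simp only [mul_assoc]
      _ = r k * C * (A * D) := by rw [h1]; simp only [mul_assoc]

/-- The counterpart for auxiliary contractions, whose Yang-Baxter relation with a swap has the two
contractions in the opposite order. -/
theorem nestedProd_mul_forward {R : X → X → B} {q : X → B}
    (h : ∀ k l, k ≠ l → R k l * q k * q l = q l * q k * R k l)
    (hc : ∀ k l m, k ≠ l → k ≠ m → l ≠ m → Commute (R k l) (q m)) :
    ∀ {L : List X}, L.Nodup →
      nestedProd R L * (L.map q).prod = (L.reverse.map q).prod * nestedProd R L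
  | [], _ => by simp [nestedProd]
  | k :: L, hL => by
    rw [List.nodup_cons] at hL
    have hne : ∀ m ∈ L, k ≠ m := by rintro m hm rfl; exact hL.1 hm
    have ih := nestedProd_mul_forward h hc hL.2
    have h1 := row_mul_mul_reverse (R := R k) (q := q) (s := q k) hL.2
      (fun l hl => h k l (hne l hl)) (fun l hl m hm hlm => hc k l m (hne l hl) (hne m hm) hlm)
    have c : Commute (q k) (nestedProd R L) := commute_nestedProd hL.2 fun l hl m hm hlm =>
      (hc l m k hlm (hne l hl).symm (hne m hm).symm).symm
    simp only [nestedProd, List.reverse_cons, List.map_append, List.prod_append, List.map_cons,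
      List.map_nil, List.prod_cons, List.prod_nil, mul_one]
    generalize (L.map (R k)).prod = A at *
    generalize (L.reverse.map q).prod = C at *
    generalize nestedProd R L = D at *
    calc A * D * (q k * (L.map q).prod) = A * (D * q k) * (L.map q).prod := by
          simp only [mul_assoc]
      _ = A * q k * (D * (L.map q).prod) := by rw [← c.eq]; simp only [mul_assoc]
      _ = A * q k * C * D := by rw [ih]; simp only [mul_assoc]
      _ = C * q k * (A * D) := by rw [h1]; simp only [mul_assoc]

/-- Contraction factors turn an auxiliary swap into an auxiliary contraction, so neither row can be
moved alone; the two pass together. Commutation of `r k` with `q k` at the same site closes the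
induction. -/
theorem nestedProd_mul_forward_mul_reverse {G : X → X → B} {r q : X → B}
    (h1 : ∀ k l, k ≠ l → G k l * r k * q l = q l * r k * G k l)
    (h2 : ∀ k l, k ≠ l → G k l * r l * q k = q k * r l * G k l)
    (h3 : ∀ k, Commute (r k) (q k))
    (hr : ∀ k l m, k ≠ l → k ≠ m → l ≠ m → Commute (G k l) (r m))
    (hq : ∀ k l m, k ≠ l → k ≠ m → l ≠ m → Commute (G k l) (q m)) :
    ∀ {L : List X}, L.Nodup →
      nestedProd G L * ((L.map r).prod * (L.reverse.map q).prod)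
        = (L.reverse.map q).prod * (L.map r).prod * nestedProd G L
  | [], _ => by simp [nestedProd]
  | k :: L, hL => by
    rw [List.nodup_cons] at hL
    have hne : ∀ m ∈ L, k ≠ m := by rintro m hm rfl; exact hL.1 hm
    have ih := nestedProd_mul_forward_mul_reverse h1 h2 h3 hr hq hL.2
    have e1 := row_mul_mul_reverse (R := G k) (q := q) (s := r k) hL.2
      (fun l hl => h1 k l (hne l hl)) (fun l hl m hm hlm => hq k l m (hne l hl) (hne m hm) hlm)
    have e2 := row_mul_row_mul (R := G k) (r := r) (s := q k) hL.2
      (fun l hl => h2 k l (hne l hl)) (fun l hl m hm hlm => hr k l m (hne l hl) (hne m hm) hlm)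
    have c1 : Commute (r k) (nestedProd G L) := commute_nestedProd hL.2 fun l hl m hm hlm =>
      (hr l m k hlm (hne l hl).symm (hne m hm).symm).symm
    have c2 : Commute (q k) (nestedProd G L) := commute_nestedProd hL.2 fun l hl m hm hlm =>
      (hq l m k hlm (hne l hl).symm (hne m hm).symm).symm
    have c3 := h3 k
    simp only [nestedProd, List.reverse_cons, List.map_append, List.prod_append, List.map_cons,
      List.map_nil, List.prod_cons, List.prod_nil, mul_one]
    generalize (L.map (G k)).prod = A at *
    generalize (L.reverse.map q).prod = C at *
    generalize (L.map r).prod = F at *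
    generalize nestedProd G L = D at *
    calc A * D * (r k * F * (C * q k)) = A * (D * r k) * F * C * q k := by simp only [mul_assoc]
      _ = A * r k * (D * (F * C)) * q k := by rw [← c1.eq]; simp only [mul_assoc]
      _ = A * r k * C * F * (D * q k) := by rw [ih]; simp only [mul_assoc]
      _ = (A * r k * C) * F * q k * D := by rw [← c2.eq]; simp only [mul_assoc]
      _ = C * r k * (A * F * q k) * D := by rw [e1]; simp only [mul_assoc]
      _ = C * (r k * q k) * F * A * D := by rw [e2]; simp only [mul_assoc]
      _ = C * q k * (r k * F) * (A * D) := by rw [c3.eq]; simp only [mul_assoc]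

theorem map_nestedProd {C : Type*} [Monoid C] (φ : B →* C) (f : X → X → B) :
    ∀ L : List X, φ (nestedProd f L) = nestedProd (fun k l => φ (f k l)) L
  | [] => by simp [nestedProd]
  | k :: L => by simp [nestedProd, map_nestedProd φ f L, map_list_prod, Function.comp_def]

/-- The first components run over a shrinking tail while the second ones run over the whole list.
The prefix `A` holds the entries already used as first components, all of which the filter discards.
-/
theorem prod_filter_product [LinearOrder X] (f : X → X → B) :
    ∀ (L A : List X), (A ++ L).Pairwise (· < ·) →
      (((L ×ˢ (A ++ L)).filter fun p => p.1 < p.2).map fun p => f p.1 p.2).prod = nestedProd f L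
  | [], A, _ => by simp [nestedProd]
  | k :: L, A, h => by
    have ih := prod_filter_product f L (A ++ [k]) (by simpa using h)
    rw [List.append_assoc, List.singleton_append] at ih
    rw [List.pairwise_append, List.pairwise_cons] at h
    obtain ⟨-, ⟨hk, -⟩, hA⟩ := h
    have hf : (A ++ k :: L).filter (fun l => k < l) = L := by
      have h1 : A.filter (fun l => k < l) = [] := List.filter_eq_nil_iff.2 fun a ha => by
        simpa using (hA a ha k (by simp)).le
      have h2 : L.filter (fun l => k < l) = L := List.filter_eq_self.2 (by simpa using hk)
      rw [List.filter_append, List.filter_cons_of_neg (by simp), h1, h2, List.nil_append]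
    rw [List.product_cons, List.filter_append, List.map_append, List.prod_append, ih,
      List.filter_map, List.map_map, nestedProd]
    congr 2
    simp only [Function.comp_def, hf]

theorem prod_map_filter (p : X → Bool) (f : X → B) (L : List X) :
    ((L.filter p).map f).prod = (L.map fun x => if p x then f x else 1).prod := by
  induction L with
  | nil => simp
  | cons a L ih => cases h : p a <;> simp [h, ih]

end NestedProd

/-! ## The Brauer algebra acting on tensors -/

section Matrices

variable (K : Type*) [CommRing K] {X : Type*} [Fintype X] [DecidableEq X] (N : ℕ)

/-- The matrix of the exchange of the tensor factors `k` and `l`. -/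
def swapMat (k l : X) : Matrix (X → Fin N) (X → Fin N) K :=
  Matrix.of fun f g => if g = f ∘ Equiv.swap k l then 1 else 0

/-- The matrix of the contraction `u ⊗ v ↦ ⟨u, v⟩ ∑_i e_i ⊗ e_i` in the factors `k` and `l`. -/
def contrMat (k l : X) : Matrix (X → Fin N) (X → Fin N) K :=
  Matrix.of fun f g =>
    if f k = f l then ∑ i, if g = Function.update (Function.update f k i) l i then 1 else 0 else 0

variable {K N}

theorem swapMat_mulVec (k l : X) (φ : (X → Fin N) → K) (f : X → Fin N) :
    (swapMat K N k l).mulVec φ f = φ (f ∘ Equiv.swap k l) := by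
  simp [swapMat, Matrix.mulVec, dotProduct]

theorem contrMat_mulVec (k l : X) (φ : (X → Fin N) → K) (f : X → Fin N) :
    (contrMat K N k l).mulVec φ f
      = if f k = f l then ∑ i, φ (Function.update (Function.update f k i) l i) else 0 := by
  simp only [contrMat, Matrix.mulVec, dotProduct, Matrix.of_apply]
  split_ifs
  · simp only [Finset.sum_mul]
    rw [Finset.sum_comm]
    simp
  · simp

theorem matrix_ext_mulVec {Y : Type*} [Fintype Y] [DecidableEq Y] {A B : Matrix Y Y K}
    (h : ∀ (φ : Y → K) (f : Y), A.mulVec φ f = B.mulVec φ f) : A = B :=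
  Matrix.mulVec_injective (funext fun φ => funext fun f => h φ f)

theorem swapMat_comm (k l : X) : swapMat K N k l = swapMat K N l k := by
  simp [swapMat, Equiv.swap_comm]

theorem contrMat_comm (k l : X) : contrMat K N k l = contrMat K N l k := by
  rcases eq_or_ne k l with rfl | h
  · rfl
  · ext f g
    simp only [contrMat, Matrix.of_apply, Function.update_comm h, eq_comm (a := f k)]

theorem swapMat_mul_self (k l : X) : swapMat K N k l * swapMat K N k l = 1 := by
  apply matrix_ext_mulVec
  intro φ f
  simp [← Matrix.mulVec_mulVec, swapMat_mulVec, Function.comp_assoc, ← Equiv.coe_trans]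

theorem swapMat_mul_contrMat (k l : X) :
    swapMat K N k l * contrMat K N k l = contrMat K N k l := by
  apply matrix_ext_mulVec
  intro φ f
  simp only [← Matrix.mulVec_mulVec, swapMat_mulVec, contrMat_mulVec]
  simp only [Function.comp_apply, Equiv.swap_apply_left, Equiv.swap_apply_right,
    eq_comm (a := f l)]
  split_ifs with hf
  · refine Finset.sum_congr rfl fun i _ => congrArg φ (funext fun m => ?_)
    simp only [Function.update_apply, Function.comp_apply, Equiv.swap_apply_def]
    grind
  · rfl

theorem contrMat_mul_swapMat {k l : X} (h : k ≠ l) :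
    contrMat K N k l * swapMat K N k l = contrMat K N k l := by
  apply matrix_ext_mulVec
  intro φ f
  simp only [← Matrix.mulVec_mulVec, swapMat_mulVec, contrMat_mulVec]
  split_ifs with hf
  · refine Finset.sum_congr rfl fun i _ => congrArg φ (funext fun m => ?_)
    simp only [Function.update_apply, Function.comp_apply, Equiv.swap_apply_def]
    grind
  · rfl

/-- The inner contraction no longer depends on the outer summation index, which therefore
contributes a closed loop, that is N. -/
theorem contrMat_mul_self {k l : X} (h : k ≠ l) :
    contrMat K N k l * contrMat K N k l = (N : K) • contrMat K N k l := by
  apply matrix_ext_mulVec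
  intro φ f
  simp only [← Matrix.mulVec_mulVec, contrMat_mulVec, Matrix.smul_mulVec, Pi.smul_apply,
    Function.update_self, Function.update_of_ne h, if_true]
  split_ifs with hf
  · rw [Finset.sum_congr rfl (g := fun _ => ∑ i, φ (Function.update (Function.update f k i) l i))]
    · simp
    · intro j _
      refine Finset.sum_congr rfl fun i _ => congrArg φ (funext fun m => ?_)
      simp only [Function.update_apply]
      grind
  · simp

theorem swapMat_mul_swapMat {k l m : X} (hkm : k ≠ m) (hlm : l ≠ m) :
    swapMat K N k l * swapMat K N k m = swapMat K N l m * swapMat K N k l := by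
  apply matrix_ext_mulVec
  intro φ f
  simp only [← Matrix.mulVec_mulVec, swapMat_mulVec]
  refine congrArg φ (funext fun a => ?_)
  simp only [Function.comp_apply, Equiv.swap_apply_def]
  grind

theorem swapMat_mul_contrMat_of_ne {k l m : X} (hkl : k ≠ l) (hkm : k ≠ m) (hlm : l ≠ m) :
    swapMat K N k l * contrMat K N k m = contrMat K N l m * swapMat K N k l := by
  apply matrix_ext_mulVec
  intro φ f
  simp only [← Matrix.mulVec_mulVec, swapMat_mulVec, contrMat_mulVec]
  simp only [Function.comp_apply, Equiv.swap_apply_left, Equiv.swap_apply_of_ne_of_ne hkm.symm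
    hlm.symm]
  split_ifs with hf
  · refine Finset.sum_congr rfl fun i _ => congrArg φ (funext fun a => ?_)
    simp only [Function.update_apply, Function.comp_apply, Equiv.swap_apply_def]
    grind
  · rfl

theorem contrMat_mul_contrMat {k l m : X} (hkl : k ≠ l) (hkm : k ≠ m) (hlm : l ≠ m) :
    contrMat K N k l * contrMat K N k m = contrMat K N k l * swapMat K N l m := by
  apply matrix_ext_mulVec
  intro φ f
  simp only [← Matrix.mulVec_mulVec, swapMat_mulVec, contrMat_mulVec]
  split_ifs with hf
  -- The second contraction compares the new value at k with the untouched value at m, so a single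
  -- term of the first sum survives.
  · rw [Finset.sum_eq_single (f m)]
    · rw [if_pos (by simp [hkl, hkm.symm, hlm.symm])]
      refine Finset.sum_congr rfl fun i _ => congrArg φ (funext fun a => ?_)
      simp only [Function.update_apply, Function.comp_apply, Equiv.swap_apply_def]
      grind
    · intro j _ hj
      rw [if_neg]
      simpa [Function.update_apply, hkl, hkm.symm, hlm.symm] using hj
    · simp
  · rfl

theorem contrMat_mul_contrMat' {k l m : X} (hkl : k ≠ l) (hkm : k ≠ m) (hlm : l ≠ m) :
    contrMat K N k l * contrMat K N k m = swapMat K N l m * contrMat K N k m := by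
  rw [contrMat_mul_contrMat hkl hkm hlm, swapMat_comm l m, contrMat_comm k m,
    swapMat_mul_contrMat_of_ne hlm.symm hkm.symm hkl.symm, contrMat_comm k l]

theorem commute_swapMat_swapMat {k l a b : X} (hka : k ≠ a) (hkb : k ≠ b) (hla : l ≠ a)
    (hlb : l ≠ b) : Commute (swapMat K N k l) (swapMat K N a b) := by
  apply matrix_ext_mulVec
  intro φ f
  simp only [← Matrix.mulVec_mulVec, swapMat_mulVec]
  refine congrArg φ (funext fun a => ?_)
  simp only [Function.comp_apply, Equiv.swap_apply_def]
  grind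

theorem commute_swapMat_contrMat {k l a b : X} (hka : k ≠ a) (hkb : k ≠ b) (hla : l ≠ a)
    (hlb : l ≠ b) : Commute (swapMat K N k l) (contrMat K N a b) := by
  apply matrix_ext_mulVec
  intro φ f
  simp only [← Matrix.mulVec_mulVec, swapMat_mulVec, contrMat_mulVec, Function.comp_apply,
    Equiv.swap_apply_of_ne_of_ne hka.symm hla.symm, Equiv.swap_apply_of_ne_of_ne hkb.symm hlb.symm]
  split_ifs with hf
  · refine Finset.sum_congr rfl fun i _ => congrArg φ (funext fun a => ?_)
    simp only [Function.update_apply, Function.comp_apply, Equiv.swap_apply_def]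
    grind
  · rfl

theorem commute_contrMat_contrMat {k l a b : X} (hka : k ≠ a) (hkb : k ≠ b) (hla : l ≠ a)
    (hlb : l ≠ b) : Commute (contrMat K N k l) (contrMat K N a b) := by
  apply matrix_ext_mulVec
  intro φ f
  simp only [← Matrix.mulVec_mulVec, contrMat_mulVec, Function.update_of_ne hka.symm,
    Function.update_of_ne hla.symm, Function.update_of_ne hkb.symm, Function.update_of_ne hlb.symm,
    Function.update_of_ne hka, Function.update_of_ne hla, Function.update_of_ne hkb,
    Function.update_of_ne hlb]
  split_ifs
  · rw [Finset.sum_comm]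
    refine Finset.sum_congr rfl fun i _ => Finset.sum_congr rfl fun j _ =>
      congrArg φ (funext fun a => ?_)
    simp only [Function.update_apply]
    grind
  · simp
  · simp
  · rfl

/-! ### Linear factors -/

theorem commute_one_sub_smul {B : Type*} [Ring B] [Algebra K B] {x y : B} (h : Commute x y)
    (a b : K) : Commute (1 - a • x) (1 - b • y) :=
  (Commute.one_left _).sub_left ((Commute.one_right _).sub_right ((h.smul_left a).smul_right b))

theorem yangBaxter_swap_swap_swap {k l m : X} (hkl : k ≠ l) (hkm : k ≠ m) (hlm : l ≠ m)
    {a b c : K} (h : a * c = a * b + b * c) :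
    (1 - a • swapMat K N k l) * (1 - b • swapMat K N k m) * (1 - c • swapMat K N l m)
      = (1 - c • swapMat K N l m) * (1 - b • swapMat K N k m) * (1 - a • swapMat K N k l) := by
  have e1 := swapMat_mul_swapMat (K := K) (N := N) hkm hlm
  have e2 := swapMat_mul_swapMat (K := K) (N := N) hkm.symm hkl.symm
  have e3 := swapMat_mul_swapMat (K := K) (N := N) hkl.symm hkm.symm
  have e4 := swapMat_mul_swapMat (K := K) (N := N) hlm hkm
  rw [swapMat_comm m l, swapMat_comm m k, swapMat_comm l k] at e2
  rw [swapMat_comm l k, swapMat_comm m k] at e3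
  rw [swapMat_comm l k] at e4
  exact yangBaxter_of_braid e1 e3.symm e4.symm e2 h

theorem yangBaxter_contr_swap_contr {k l m : X} (hkl : k ≠ l) (hkm : k ≠ m) (hlm : l ≠ m)
    {a b c : K} (h : a * b + a * c + b * c = a * b * c * N) :
    (1 - a • contrMat K N k l) * (1 - b • swapMat K N m k) * (1 - c • contrMat K N m l)
      = (1 - c • contrMat K N m l) * (1 - b • swapMat K N m k) * (1 - a • contrMat K N k l) := by
  have e1 : contrMat K N k l * swapMat K N m k = swapMat K N m k * contrMat K N m l :=
    (swapMat_mul_contrMat_of_ne hkm.symm hlm.symm hkl).symm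
  have e2 : contrMat K N k l * contrMat K N m l = swapMat K N m k * contrMat K N m l := by
    rw [contrMat_comm k l, contrMat_comm m l, contrMat_mul_contrMat' hkl.symm hlm hkm,
      swapMat_comm k m]
  have e3 : contrMat K N m l * swapMat K N m k = swapMat K N m k * contrMat K N k l := by
    rw [swapMat_comm m k, swapMat_mul_contrMat_of_ne hkm hkl hlm.symm]
  have e4 : contrMat K N m l * contrMat K N k l = swapMat K N m k * contrMat K N k l := by
    rw [contrMat_comm k l, contrMat_comm m l, contrMat_mul_contrMat' hlm hkl.symm hkm.symm]
  exact yangBaxter_of_contraction_swap_contraction e1 e2 e3 e4 (contrMat_mul_self hkl)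
    (contrMat_mul_self hlm.symm) h

theorem yangBaxter_contr_contr_swap {k l m : X} (hkl : k ≠ l) (hkm : k ≠ m) (hlm : l ≠ m)
    {a b c : K} (h : a * b + a * c = b * c) :
    (1 - a • contrMat K N k l) * (1 - b • contrMat K N k m) * (1 - c • swapMat K N l m)
      = (1 - c • swapMat K N l m) * (1 - b • contrMat K N k m) * (1 - a • contrMat K N k l) := by
  have e1 := contrMat_mul_contrMat (K := K) (N := N) hkl hkm hlm
  have e3 := contrMat_mul_contrMat' (K := K) (N := N) hkm hkl hlm.symm
  have e4 := contrMat_mul_contrMat (K := K) (N := N) hkm hkl hlm.symm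
  have e5 := contrMat_mul_contrMat' (K := K) (N := N) hkl hkm hlm
  rw [swapMat_comm m l] at e3 e4
  exact yangBaxter_of_contraction_contraction_swap e1 (e4.symm.trans e3) e3 (e5.symm.trans e1)
    (swapMat_mul_self l m) h

end Matrices

/-! ## Antisymmetry in the columns -/

section Antisymmetry

/-- Antisymmetry gives 2Y = (1 - p)Y, so 2uY = (1 - p)vY, and p negates the image of 1 - p. -/
theorem mul_eq_neg_of_exchange {B : Type*} [Ring B] [Algebra ℂ B] {p u v Y : B} (hp : p * p = 1)
    (h : u * (1 - p) = (1 - p) * v) (hY : p * Y = -Y) : p * (u * Y) = -(u * Y) := by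
  have h2 : (2 : ℂ) • Y = (1 - p) * Y := by rw [sub_mul, hY, one_mul, two_smul]; abel
  have h3 : p * (1 - p) = -(1 - p) := by rw [mul_sub, hp, mul_one, neg_sub]
  have h4 : (2 : ℂ) • (p * (u * Y)) = (2 : ℂ) • (-(u * Y)) := by
    calc (2 : ℂ) • (p * (u * Y)) = p * (u * ((2 : ℂ) • Y)) := by simp only [mul_smul_comm]
      _ = p * (1 - p) * (v * Y) := by
          rw [h2, ← mul_assoc u, h]; simp only [mul_assoc]
      _ = -(u * (1 - p) * Y) := by rw [h3, h]; simp only [neg_mul, mul_assoc]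
      _ = (2 : ℂ) • (-(u * Y)) := by rw [mul_assoc, ← h2, mul_smul_comm, smul_neg]
  exact smul_right_injective B (two_ne_zero (α := ℂ)) h4

/-- Only the two adjacent factors at l and m see the exchange p; they preserve the sign by the
previous lemma, and all others commute with p. -/
theorem row_mul_eq_neg {B X : Type*} [Ring B] [Algebra ℂ B] {f : X → B} {p Y : B} {L₁ L₂ : List X}
    {l m : X} (hp : p * p = 1) (h₁ : ∀ a ∈ L₁, Commute p (f a)) (h₂ : ∀ a ∈ L₂, Commute p (f a))
    (h : f l * f m * (1 - p) = (1 - p) * f m * f l) (hY : p * Y = -Y) :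
    p * (((L₁ ++ l :: m :: L₂).map f).prod * Y) = -(((L₁ ++ l :: m :: L₂).map f).prod * Y) := by
  simp only [List.map_append, List.map_cons, List.prod_append, List.prod_cons]
  have c1 := commute_prod_map h₁
  have c2 := commute_prod_map h₂
  have hY2 : p * ((L₂.map f).prod * Y) = -((L₂.map f).prod * Y) := by
    rw [← mul_assoc, c2.eq, mul_assoc, hY, mul_neg]
  have hY3 := mul_eq_neg_of_exchange hp (h.trans (mul_assoc _ _ _)) hY2
  simp only [mul_assoc] at hY3 ⊢
  rw [← mul_assoc p, c1.eq, mul_assoc, hY3, mul_neg]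

theorem row_mul_row_mul_exchange {X B : Type*} [Ring B] {f g : X → B} {s : B} :
    ∀ {L : List X}, L.Nodup → (∀ l ∈ L, f l * g l * s = s * (g l * f l)) →
      (∀ l ∈ L, ∀ m ∈ L, l ≠ m → Commute (f l) (g m)) →
      (L.map f).prod * (L.map g).prod * s = s * ((L.map g).prod * (L.map f).prod)
  | [], _, _, _ => by simp
  | l :: L, hL, h, hc => by
    rw [List.nodup_cons] at hL
    have ih := row_mul_row_mul_exchange hL.2 (fun m hm => h m (by simp [hm]))
      (fun a ha b hb => hc a (by simp [ha]) b (by simp [hb]))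
    have hne : ∀ m ∈ L, l ≠ m := by rintro m hm rfl; exact hL.1 hm
    have c1 : Commute (g l) (L.map f).prod :=
      commute_prod_map fun m hm => (hc m (by simp [hm]) l (by simp) (hne m hm).symm).symm
    have c2 : Commute (f l) (L.map g).prod :=
      commute_prod_map fun m hm => hc l (by simp) m (by simp [hm]) (hne m hm)
    simp only [List.map_cons, List.prod_cons]
    generalize (L.map f).prod = A at *
    generalize (L.map g).prod = C at *
    calc f l * A * (g l * C) * s = f l * (A * g l) * C * s := by simp only [mul_assoc]
      _ = f l * g l * (A * C * s) := by rw [← c1.eq]; simp only [mul_assoc]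
      _ = (f l * g l * s) * C * A := by rw [ih]; simp only [mul_assoc]
      _ = s * g l * (f l * C) * A := by rw [h l (by simp)]; simp only [mul_assoc]
      _ = s * (g l * C * (f l * A)) := by rw [c2.eq]; simp only [mul_assoc]

variable {X : Type*} {N : ℕ}

/-- Adjacent members of the list in the same column have parameters with difference `1`. -/
def ColStep (col : X → ℕ) (c : X → ℂ) (L : List X) : Prop :=
  ∀ L₁ l m L₂, L = L₁ ++ l :: m :: L₂ → col l = col m → c l - c m = 1

variable {col : X → ℕ}

theorem ColStep.tail {k : X} {L : List X} {c : X → ℂ} (h : ColStep col c (k :: L)) :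
    ColStep col c L :=
  fun L₁ l m L₂ hL hc => h (k :: L₁) l m L₂ (by rw [hL]; rfl) hc

variable [Fintype X] [DecidableEq X]

/-- Multiplication on the left by the exchange of adjacent members of a list in the same column
changes the sign. -/
def ColAnti (col : X → ℕ) (L : List X) (Z : Matrix (X → Fin N) (X → Fin N) ℂ) : Prop :=
  ∀ L₁ l m L₂, L = L₁ ++ l :: m :: L₂ → col l = col m → swapMat ℂ N l m * Z = -Z

theorem ColAnti.tail {k : X} {L : List X} {Z : Matrix (X → Fin N) (X → Fin N) ℂ}
    (h : ColAnti col (k :: L) Z) : ColAnti col L Z :=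
  fun L₁ l m L₂ hL hc => h (k :: L₁) l m L₂ (by rw [hL]; rfl) hc

variable (N) in
/-- The factor `1 - P_kl / (c_k - c_l)`. -/
def swapFactor (c : X → ℂ) (k l : X) : Matrix (X → Fin N) (X → Fin N) ℂ :=
  1 - (c k - c l)⁻¹ • swapMat ℂ N k l

variable (N) in
/-- The factor `1 - Q_kl / (c_k + c_l)`. -/
def contrFactor (c : X → ℂ) (k l : X) : Matrix (X → Fin N) (X → Fin N) ℂ :=
  1 - (c k + c l)⁻¹ • contrMat ℂ N k l

theorem commute_swapMat_swapFactor {c : X → ℂ} {k l a b : X} (hka : k ≠ a) (hkb : k ≠ b)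
    (hla : l ≠ a) (hlb : l ≠ b) : Commute (swapMat ℂ N k l) (swapFactor N c a b) :=
  (Commute.one_right _).sub_right ((commute_swapMat_swapMat hka hkb hla hlb).smul_right _)

theorem commute_swapMat_contrFactor {c : X → ℂ} {k l a b : X} (hka : k ≠ a) (hkb : k ≠ b)
    (hla : l ≠ a) (hlb : l ≠ b) : Commute (swapMat ℂ N k l) (contrFactor N c a b) :=
  (Commute.one_right _).sub_right ((commute_swapMat_contrMat hka hkb hla hlb).smul_right _)

/-- A parameter difference 1 turns the third Yang-Baxter factor into 1 - P_lm, twice the projection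
onto antisymmetric tensors. -/
theorem swapFactor_mul_swapFactor {c : X → ℂ} {k l m : X} (hkl : k ≠ l) (hkm : k ≠ m) (hlm : l ≠ m)
    (h1 : c k ≠ c l) (h2 : c k ≠ c m) (h : c l - c m = 1) :
    swapFactor N c k l * swapFactor N c k m * (1 - swapMat ℂ N l m)
      = (1 - swapMat ℂ N l m) * swapFactor N c k m * swapFactor N c k l := by
  have := yangBaxter_swap_swap_swap (K := ℂ) (N := N) hkl hkm hlm (a := (c k - c l)⁻¹)
    (b := (c k - c m)⁻¹) (c := 1) (by
      have := sub_ne_zero.2 h1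
      have := sub_ne_zero.2 h2
      field_simp
      linear_combination h)
  simpa only [one_smul, swapFactor] using this

theorem contrFactor_mul_contrFactor {c : X → ℂ} {k l m : X} (hkl : k ≠ l) (hkm : k ≠ m)
    (hlm : l ≠ m) (h1 : c k + c l ≠ 0) (h2 : c k + c m ≠ 0) (h : c l - c m = 1) :
    contrFactor N c k l * contrFactor N c k m * (1 - swapMat ℂ N l m)
      = (1 - swapMat ℂ N l m) * contrFactor N c k m * contrFactor N c k l := by
  have := yangBaxter_contr_contr_swap (K := ℂ) (N := N) hkl hkm hlm (a := (c k + c l)⁻¹)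
    (b := (c k + c m)⁻¹) (c := 1) (by field_simp; linear_combination -h)
  simpa only [one_smul, contrFactor] using this

theorem contrFactor_comm (c : X → ℂ) (k l : X) : contrFactor N c k l = contrFactor N c l k := by
  rw [contrFactor, contrFactor, contrMat_comm, add_comm]

/-- If the two neighbours come first, the leftmost factor is 1 - P itself; otherwise the sign passes
through the row of the head by Yang-Baxter. -/
theorem colAnti_nestedProd_swapFactor {c : X → ℂ} :
    ∀ {L : List X}, L.Nodup → ColStep col c L → L.Pairwise (fun k l => c k ≠ c l) →
      ColAnti col L (nestedProd (swapFactor N c) L)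
  | [], _, _, _ => by intro L₁ l m L₂ h; simp at h
  | k :: L, hL, hs, hp => by
    have ih := colAnti_nestedProd_swapFactor (List.nodup_cons.1 hL).2 hs.tail
      (List.pairwise_cons.1 hp).2
    intro L₁ l m L₂ h hcol
    have h1 := hs L₁ l m L₂ h hcol
    rw [h] at hL hp
    rcases L₁ with _ | ⟨a, L₁⟩
    · obtain ⟨rfl, rfl⟩ : k = l ∧ L = m :: L₂ := by simpa using h
      simp only [nestedProd, List.map_cons, List.prod_cons, ← mul_assoc]
      have h2 : swapMat ℂ N k m * swapFactor N c k m = -swapFactor N c k m := by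
        rw [swapFactor, h1, inv_one, one_smul, mul_sub, swapMat_mul_self, mul_one, neg_sub]
      simp only [h2, neg_mul]
    · obtain ⟨rfl, rfl⟩ : k = a ∧ L = L₁ ++ l :: m :: L₂ := by simpa using h
      have hd : ∀ b ∈ L₁ ++ L₂, l ≠ b ∧ m ≠ b := by
        intro b hb
        constructor <;> rintro rfl <;> simp [List.nodup_append] at hL hb <;> grind
      have hk : k ≠ l ∧ k ≠ m ∧ l ≠ m := by
        simp [List.nodup_append] at hL; grind
      simp only [List.cons_append, List.pairwise_cons] at hp
      refine row_mul_eq_neg (swapMat_mul_self l m) ?_ ?_ ?_ (ih L₁ l m L₂ rfl hcol)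
      · exact fun b hb => commute_swapMat_swapFactor hk.1.symm (hd b (by simp [hb])).1 hk.2.1.symm
          (hd b (by simp [hb])).2
      · exact fun b hb => commute_swapMat_swapFactor hk.1.symm (hd b (by simp [hb])).1 hk.2.1.symm
          (hd b (by simp [hb])).2
      · exact swapFactor_mul_swapFactor hk.1 hk.2.1 hk.2.2 (hp.1 l (by simp)) (hp.1 m (by simp)) h1

variable (N) in
/-- The factor `1 - Q_kl / (c_k + c_l)` for `k` and `l` in different columns, and `1` otherwise. -/
def contrFactor' (col : X → ℕ) (c : X → ℂ) (k l : X) : Matrix (X → Fin N) (X → Fin N) ℂ :=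
  if col k ≠ col l then contrFactor N c k l else 1

theorem commute_swapMat_contrFactor' {c : X → ℂ} {k l a b : X} (hka : k ≠ a) (hkb : k ≠ b)
    (hla : l ≠ a) (hlb : l ≠ b) : Commute (swapMat ℂ N k l) (contrFactor' N col c a b) := by
  unfold contrFactor'
  split_ifs
  · exact commute_swapMat_contrFactor hka hkb hla hlb
  · exact Commute.one_right _

theorem contrFactor'_comm (c : X → ℂ) (k l : X) :
    contrFactor' N col c k l = contrFactor' N col c l k := by
  simp only [contrFactor', contrFactor_comm c k l, ne_comm]

theorem contrFactor'_mul_contrFactor' {c : X → ℂ} {k l m : X} (hkl : k ≠ l) (hkm : k ≠ m)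
    (hlm : l ≠ m) (h1 : c k + c l ≠ 0) (h2 : c k + c m ≠ 0) (h : c l - c m = 1)
    (hcol : col l = col m) :
    contrFactor' N col c k l * contrFactor' N col c k m * (1 - swapMat ℂ N l m)
      = (1 - swapMat ℂ N l m) * contrFactor' N col c k m * contrFactor' N col c k l := by
  simp only [contrFactor', hcol]
  split_ifs
  · exact contrFactor_mul_contrFactor hkl hkm hlm h1 h2 h
  · simp

theorem commute_contrFactor' {c : X → ℂ} {k l a b : X} (hka : k ≠ a) (hkb : k ≠ b)
    (hla : l ≠ a) (hlb : l ≠ b) :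
    Commute (contrFactor' N col c k l) (contrFactor' N col c a b) := by
  unfold contrFactor' contrFactor
  split_ifs
  · exact commute_one_sub_smul (commute_contrMat_contrMat hka hkb hla hlb) _ _
  all_goals first | exact Commute.one_right _ | exact Commute.one_left _

/-- The reduced product of contractions has no factor 1 - P to supply the sign, so the sign is taken
from `Z` and transported through the rows. -/
theorem colAnti_nestedProd_contrFactor' {c : X → ℂ} (h0 : ∀ k l, k ≠ l → c k + c l ≠ 0)
    {Z : Matrix (X → Fin N) (X → Fin N) ℂ} :
    ∀ {L : List X}, L.Nodup → ColStep col c L → ColAnti col L Z →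
      ColAnti col L (nestedProd (contrFactor' N col c) L * Z)
  | [], _, _, _ => by intro L₁ l m L₂ h; simp at h
  | k :: L, hL, hs, hZ => by
    have ih := colAnti_nestedProd_contrFactor' h0 (List.nodup_cons.1 hL).2 hs.tail hZ.tail
    intro L₁ l m L₂ h hcol
    have h1 := hs L₁ l m L₂ h hcol
    have h2 := hZ L₁ l m L₂ h hcol
    rw [h] at hL
    rcases L₁ with _ | ⟨a, L₁⟩
    · obtain ⟨rfl, rfl⟩ : k = l ∧ L = m :: L₂ := by simpa using h
      have hd : ∀ b ∈ L₂, k ≠ b ∧ m ≠ b := by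
        intro b hb
        constructor <;> rintro rfl <;> simp at hL hb <;> grind
      have hkm : k ≠ m := by simp at hL; grind
      have hL2 : L₂.Nodup := by simp at hL; grind
      have hself : contrFactor' N col c k m = 1 := if_neg (by simpa using hcol)
      simp only [nestedProd, List.map_cons, List.prod_cons, hself, one_mul]
      have c1 : Commute (swapMat ℂ N k m) (nestedProd (contrFactor' N col c) L₂) :=
        commute_nestedProd hL2 fun a ha b hb _ => commute_swapMat_contrFactor' (hd a ha).1
          (hd b hb).1 (hd a ha).2 (hd b hb).2
      have h3 : swapMat ℂ N k m * (nestedProd (contrFactor' N col c) L₂ * Z)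
          = -(nestedProd (contrFactor' N col c) L₂ * Z) := by
        rw [← mul_assoc, c1.eq, mul_assoc, h2, mul_neg]
      -- The factor joining k and m has been omitted, so their rows run over the same list; together
      -- they pass 1 - P_km, interchanging their order.
      have h4 := row_mul_row_mul_exchange (f := contrFactor' N col c k)
        (g := contrFactor' N col c m) (s := 1 - swapMat ℂ N k m) hL2
        (fun b hb => by
          rw [contrFactor'_comm c k, contrFactor'_comm c m, ← mul_assoc]
          exact contrFactor'_mul_contrFactor' (hd b hb).1.symm (hd b hb).2.symm hkm
            (h0 _ _ (hd b hb).1.symm) (h0 _ _ (hd b hb).2.symm) h1 hcol)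
        (fun a ha b hb hab => commute_contrFactor' hkm (hd b hb).1 (hd a ha).2.symm hab)
      have h5 := mul_eq_neg_of_exchange (swapMat_mul_self k m) h4 h3
      simpa only [mul_assoc] using h5
    · obtain ⟨rfl, rfl⟩ : k = a ∧ L = L₁ ++ l :: m :: L₂ := by simpa using h
      have hd : ∀ b ∈ L₁ ++ L₂, l ≠ b ∧ m ≠ b := by
        intro b hb
        constructor <;> rintro rfl <;> simp [List.nodup_append] at hL hb <;> grind
      have hk : k ≠ l ∧ k ≠ m ∧ l ≠ m := by
        simp [List.nodup_append] at hL; grind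
      rw [nestedProd, mul_assoc]
      refine row_mul_eq_neg (swapMat_mul_self l m) ?_ ?_ ?_ (ih L₁ l m L₂ rfl hcol)
      · exact fun b hb => commute_swapMat_contrFactor' hk.1.symm (hd b (by simp [hb])).1
          hk.2.1.symm (hd b (by simp [hb])).2
      · exact fun b hb => commute_swapMat_contrFactor' hk.1.symm (hd b (by simp [hb])).1
          hk.2.1.symm (hd b (by simp [hb])).2
      · exact contrFactor'_mul_contrFactor' hk.1 hk.2.1 hk.2.2 (h0 _ _ hk.1) (h0 _ _ hk.2.1) h1
          hcol

/-- Since Q P = Q, antisymmetry gives QZ = QPZ = -QZ. -/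
theorem contrMat_mul_eq_zero {k l : X} (hkl : k ≠ l) {Z : Matrix (X → Fin N) (X → Fin N) ℂ}
    (h : swapMat ℂ N k l * Z = -Z) : contrMat ℂ N k l * Z = 0 := by
  have h1 : contrMat ℂ N k l * Z = -(contrMat ℂ N k l * Z) := by
    conv_lhs => rw [← contrMat_mul_swapMat hkl, mul_assoc, h, mul_neg]
  ext f g
  exact self_eq_neg.1 (congrFun (congrFun h1 f) g)

/-- Non-adjacent exchanges within a column are conjugates of adjacent ones, reached by moving down
the column one box at a time. -/
theorem ColAnti.swapMat_mul {k : X} {Z : Matrix (X → Fin N) (X → Fin N) ℂ} (C D : List X)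
    (hL : (k :: C).Nodup) (hcol : ∀ b ∈ C, col b = col k) (hZ : ColAnti col (k :: (C ++ D)) Z) :
    ∀ b ∈ C, swapMat ℂ N k b * Z = -Z := by
  induction C using List.reverseRecOn generalizing D with
  | nil => simp
  | append_singleton C b ih =>
    rw [List.append_assoc] at hZ
    have ih' := ih _ (by simp [List.nodup_append] at hL ⊢; grind)
      (fun a ha => hcol a (by simp [ha])) hZ
    intro a ha
    rcases List.mem_append.1 ha with ha | ha
    · exact ih' a ha
    · obtain rfl : a = b := by simpa using ha
      rcases List.eq_nil_or_concat C with rfl | ⟨C', b, rfl⟩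
      · exact hZ [] k a D (by simp) (hcol a (by simp)).symm
      · have e1 := ih' b (by simp)
        have e2 := hZ (k :: C') b a D (by simp)
          ((hcol b (by simp)).trans (hcol a (by simp)).symm)
        have hne : b ≠ a ∧ k ≠ a := by simp [List.nodup_append] at hL; grind
        have e3 := swapMat_mul_swapMat (K := ℂ) (N := N) (k := b) (l := k) (m := a) hne.1 hne.2
        have e4 := congrArg (· * Z) e3
        simp only [mul_assoc] at e4
        rw [e2, swapMat_comm b k, e1, mul_neg, mul_neg, e1] at e4
        exact (neg_injective e4).symm

/-- In the row of k the boxes of its own column come first. What stands to their right is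
antisymmetric in that column, so each contraction of k with such a box vanishes there. -/
theorem nestedProd_contrFactor_mul {c : X → ℂ} (h0 : ∀ k l, k ≠ l → c k + c l ≠ 0)
    {Z : Matrix (X → Fin N) (X → Fin N) ℂ} :
    ∀ {L : List X}, L.Nodup → ColStep col c L → L.Pairwise (fun k l => col k ≤ col l) →
      ColAnti col L Z →
      nestedProd (contrFactor N c) L * Z = nestedProd (contrFactor' N col c) L * Z
  | [], _, _, _, _ => rfl
  | k :: L, hL, hs, hp, hZ => by
    have ih := nestedProd_contrFactor_mul h0 (List.nodup_cons.1 hL).2 hs.tail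
      (List.pairwise_cons.1 hp).2 hZ.tail
    have ha := colAnti_nestedProd_contrFactor' h0 hL hs hZ
    obtain ⟨C, D, rfl, hC, hD⟩ : ∃ C D, L = C ++ D ∧ (∀ b ∈ C, col b = col k) ∧
        ∀ b ∈ D, col k ≠ col b := by
      refine ⟨L.takeWhile (fun b => col b = col k), L.dropWhile (fun b => col b = col k),
        (List.takeWhile_append_dropWhile).symm, fun b hb => by
          simpa using List.mem_takeWhile_imp hb, ?_⟩
      rw [List.pairwise_cons] at hp
      obtain ⟨hk, hp⟩ := hp
      clear ih ha hs hZ hL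
      induction L with
      | nil => simp
      | cons a L ih =>
        rw [List.pairwise_cons] at hp
        by_cases hac : col a = col k
        · simpa [hac] using ih (fun b hb => hk b (by simp [hb])) hp.2
        · rw [List.dropWhile_cons_of_neg (by simpa using hac)]
          intro b hb
          have h1 := hk a (by simp)
          rcases List.mem_cons.1 hb with rfl | hb
          · exact fun h => hac h.symm
          · have h2 := hp.1 b hb
            omega
    rw [nestedProd, nestedProd, mul_assoc, mul_assoc, ih]
    rw [nestedProd, mul_assoc] at ha
    have h1 : (D.map (contrFactor N c k)).prod = (D.map (contrFactor' N col c k)).prod := by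
      congr 1
      exact List.map_congr_left fun b hb => (if_pos (hD b hb)).symm
    have h2 : (C.map (contrFactor' N col c k)).prod = 1 := by
      apply List.prod_eq_one
      intro x hx
      obtain ⟨b, hb, rfl⟩ := List.mem_map.1 hx
      exact if_neg (by simpa using (hC b hb).symm)
    -- Since the reduced factors over `C` are 1, the full reduced product is exactly what the
    -- contractions over `C` act on.
    have hsw := ha.swapMat_mul C D (hL.sublist (by simp)) hC
    have hne : ∀ b ∈ C, k ≠ b := by
      rintro b hb rfl
      exact (List.nodup_cons.1 hL).1 (by simp [hb])
    simp only [List.map_append, List.prod_append, h1, h2, one_mul] at hsw ⊢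
    rw [mul_assoc]
    generalize (D.map (contrFactor' N col c k)).prod * _ = W at hsw ⊢
    clear h2 hC ih ha hs hZ hL hp
    induction C with
    | nil => simp
    | cons b C ih =>
      rw [List.map_cons, List.prod_cons, mul_assoc, ih (fun a ha => hne a (by simp [ha]))
        (fun a ha => hsw a (by simp [ha])), contrFactor, sub_mul, smul_mul_assoc,
        contrMat_mul_eq_zero (hne b (by simp)) (hsw b (by simp)), smul_zero, sub_zero, one_mul]

end Antisymmetry

/-! ## Regularity of the fusion product -/

section Fusion

variable {X : Type*} {N : ℕ}

/-- If a member `l` of the list has the same parameter as an earlier member, then the member right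
before `l` lies between the two, in the column of `l`. -/
def DiagonalPred (col : X → ℕ) (c : X → ℂ) (L : List X) : Prop :=
  ∀ L₁ k L₂ l L₃, L = L₁ ++ k :: (L₂ ++ l :: L₃) → c k = c l →
    ∃ L₂' p, L₂ = L₂' ++ [p] ∧ col p = col l

theorem DiagonalPred.tail {col : X → ℕ} {c : X → ℂ} {k : X} {L : List X}
    (h : DiagonalPred col c (k :: L)) : DiagonalPred col c L :=
  fun L₁ a L₂ l L₃ hL hc => h (k :: L₁) a L₂ l L₃ (by rw [hL]; rfl) hc

variable [Fintype X] [DecidableEq X]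

/-- On vectors antisymmetric in l and m the coefficient of P_km is (c_k - c_m)⁻¹(1 + (c_k - c_l)⁻¹)
= (c_k - c_l)⁻¹. The pole at c_k = c_m disappears. -/
theorem swapFactor_mul_swapFactor_mul {c : X → ℂ} {k l m : X} (hkm : k ≠ m)
    (hlm : l ≠ m) (h1 : c k ≠ c l) (h2 : c k ≠ c m) (h : c l - c m = 1)
    {Z : Matrix (X → Fin N) (X → Fin N) ℂ} (hZ : swapMat ℂ N l m * Z = -Z) :
    swapFactor N c k l * (swapFactor N c k m * Z)
      = (1 - (c k - c l)⁻¹ • (swapMat ℂ N k l + swapMat ℂ N k m)) * Z := by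
  have e : swapMat ℂ N k l * (swapMat ℂ N k m * Z) = -(swapMat ℂ N k m * Z) := by
    have e2 := swapMat_mul_swapMat (K := ℂ) (N := N) (k := k) (l := l) (m := m) hkm hlm
    have e4 := swapMat_mul_swapMat (K := ℂ) (N := N) (k := l) (l := m) (m := k) (by
      rintro rfl; exact h1 rfl) hkm.symm
    rw [swapMat_comm l k, swapMat_comm m k] at e4
    rw [← mul_assoc, e2, e4, mul_assoc, hZ, mul_neg]
  have u1 := sub_ne_zero.2 h1
  have u2 := sub_ne_zero.2 h2
  have hs : (c k - c m)⁻¹ + (c k - c l)⁻¹ * (c k - c m)⁻¹ = (c k - c l)⁻¹ := by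
    field_simp
    linear_combination -h
  simp only [swapFactor, sub_mul, mul_sub, smul_mul_assoc, mul_smul_comm, one_mul, e, smul_add,
    add_mul]
  linear_combination (norm := module) (-hs) • (swapMat ℂ N k m * Z)

variable {col : X → ℕ} {T : Type*} {F : Filter T} {c : T → X → ℂ} {c₀ : X → ℂ}

theorem tendsto_swapFactor {k l : X} (hc : ∀ k, Filter.Tendsto (fun t => c t k) F (nhds (c₀ k)))
    (h : c₀ k ≠ c₀ l) :
    Filter.Tendsto (fun t => swapFactor N (c t) k l) F (nhds (swapFactor N c₀ k l)) :=
  tendsto_const_nhds.sub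
    ((((hc k).sub (hc l)).inv₀ (sub_ne_zero.2 h)).smul_const (swapMat ℂ N k l))

/-- The row is read from the left with a prefix `A` already treated. The invariant is that the next
factor is regular: a singular one is always absorbed together with its regular predecessor. -/
theorem exists_tendsto_row_mul {k : X} (hc : ∀ k, Filter.Tendsto (fun t => c t k) F (nhds (c₀ k)))
    (Z : T → Matrix (X → Fin N) (X → Fin N) ℂ) {E : Matrix (X → Fin N) (X → Fin N) ℂ}
    (hZ : Filter.Tendsto Z F (nhds E)) :
    ∀ (L A : List X), (k :: (A ++ L)).Nodup → ColStep col c₀ (A ++ L) →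
      DiagonalPred col c₀ (k :: (A ++ L)) →
      (∀ᶠ t in F, ColStep col (c t) (A ++ L) ∧ (∀ l ∈ L, c t k ≠ c t l) ∧
        ColAnti col (A ++ L) (Z t)) →
      (∀ l L', L = l :: L' → c₀ k ≠ c₀ l) →
      ∃ E', Filter.Tendsto (fun t => (L.map (swapFactor N (c t) k)).prod * Z t) F (nhds E')
  | [], _, _, _, _, _, _ => ⟨E, by simpa using hZ⟩
  | [l], _, _, _, _, _, h => ⟨_, by
      simpa using (tendsto_swapFactor (N := N) hc (h l [] rfl)).mul hZ⟩
  | l :: m :: L, A, hn, hs, hd, he, h => by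
    have hkl := h l _ rfl
    by_cases hm : c₀ k = c₀ m
    · obtain ⟨B, p, hB, hp⟩ := hd [] k (A ++ [l]) m L (by simp) hm
      obtain rfl : l = p := (by simpa using hB : _ ∧ l = p).2
      have hlm : c₀ l - c₀ m = 1 := hs A l m L rfl hp
      have ne : k ≠ l ∧ k ≠ m ∧ l ≠ m := by
        simp [List.nodup_append] at hn; grind
      have hda : ∀ b ∈ L, l ≠ b ∧ m ≠ b := by
        intro b hb
        constructor <;> rintro rfl <;> simp [List.nodup_append] at hn <;> grind
      obtain ⟨E', hE'⟩ := exists_tendsto_row_mul hc Z hZ L (A ++ [l, m]) (by simpa using hn)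
        (by simpa using hs) (by simpa using hd) (by
          filter_upwards [he] with t ht
          refine ⟨by simpa using ht.1, fun b hb => ht.2.1 b (by simp [hb]), by simpa using ht.2.2⟩)
        (by
          -- Singular factors cannot be consecutive: b would then follow m in a column, with a
          -- parameter smaller by 1, whereas both equal that of k.
          rintro b L' rfl hb
          obtain ⟨B', q, hB', hq⟩ := hd [] k (A ++ [l, m]) b L' (by simp) hb
          have hmq : m = q := by
            have := congrArg List.getLast? hB'
            simpa using this
          subst hmq
          have := hs (A ++ [l]) m b L' (by simp) hq
          rw [← hb, hm, sub_self] at this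
          exact zero_ne_one this)
      refine ⟨(1 - (c₀ k - c₀ l)⁻¹ • (swapMat ℂ N k l + swapMat ℂ N k m)) * E', ?_⟩
      have ht : Filter.Tendsto
          (fun t => (1 - (c t k - c t l)⁻¹ • (swapMat ℂ N k l + swapMat ℂ N k m))) F
          (nhds (1 - (c₀ k - c₀ l)⁻¹ • (swapMat ℂ N k l + swapMat ℂ N k m))) :=
        tendsto_const_nhds.sub ((((hc k).sub (hc l)).inv₀ (sub_ne_zero.2 hkl)).smul_const _)
      refine (ht.mul hE').congr' ?_
      filter_upwards [he] with t ht
      have hanti : swapMat ℂ N l m * ((L.map (swapFactor N (c t) k)).prod * Z t)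
          = -((L.map (swapFactor N (c t) k)).prod * Z t) := by
        have hcm : Commute (swapMat ℂ N l m) (L.map (swapFactor N (c t) k)).prod :=
          commute_prod_map fun b hb => commute_swapMat_swapFactor ne.1.symm (hda b hb).1
            ne.2.1.symm (hda b hb).2
        rw [← mul_assoc, hcm.eq, mul_assoc, ht.2.2 A l m L rfl hp, mul_neg]
      rw [List.map_cons, List.map_cons, List.prod_cons, List.prod_cons, mul_assoc, mul_assoc,
        swapFactor_mul_swapFactor_mul ne.2.1 ne.2.2 (ht.2.1 l (by simp))
          (ht.2.1 m (by simp)) (ht.1 A l m L rfl hp) hanti]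
    · obtain ⟨E', hE'⟩ := exists_tendsto_row_mul hc Z hZ (m :: L) (A ++ [l]) (by simpa using hn)
        (by simpa using hs) (by simpa using hd) (by
          filter_upwards [he] with t ht
          refine ⟨by simpa using ht.1, fun b hb => ht.2.1 b (by simp [List.mem_cons.1 hb]),
            by simpa using ht.2.2⟩)
        (by
          rintro b L' hb
          obtain ⟨rfl, -⟩ : m = b ∧ _ := by simpa using hb
          exact hm)
      refine ⟨_, ((tendsto_swapFactor (N := N) hc hkl).mul hE').congr fun t => ?_⟩
      simp only [List.map_cons, List.prod_cons, mul_assoc]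

/-- Rows are added from the last box backwards. The part already built is antisymmetric off the
singular point, which makes the next row regular; the box right after k is never singular for it. -/
theorem exists_tendsto_nestedProd_swapFactor
    (hc : ∀ k, Filter.Tendsto (fun t => c t k) F (nhds (c₀ k))) :
    ∀ L : List X, L.Nodup → ColStep col c₀ L → DiagonalPred col c₀ L →
      (∀ᶠ t in F, ColStep col (c t) L ∧ L.Pairwise fun k l => c t k ≠ c t l) →
      ∃ E, Filter.Tendsto (fun t => nestedProd (swapFactor N (c t)) L) F (nhds E)
  | [], _, _, _, _ => ⟨1, tendsto_const_nhds⟩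
  | k :: L, hn, hs, hd, he => by
    have hn' := (List.nodup_cons.1 hn).2
    obtain ⟨E, hE⟩ := exists_tendsto_nestedProd_swapFactor hc L hn' hs.tail hd.tail
      (by filter_upwards [he] with t ht using ⟨ht.1.tail, (List.pairwise_cons.1 ht.2).2⟩)
    refine exists_tendsto_row_mul (col := col) hc _ hE L [] hn hs.tail hd ?_ ?_
    · filter_upwards [he] with t ht
      obtain ⟨h1, h2⟩ := List.pairwise_cons.1 ht.2
      exact ⟨ht.1.tail, h1, colAnti_nestedProd_swapFactor hn' ht.1.tail h2⟩
    · rintro l L' rfl h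
      obtain ⟨B, p, hB, -⟩ := hd [] k [] l L' rfl h
      simp at hB

end Fusion

/-! ## Adjoining an auxiliary tensor factor -/

section Auxiliary

open PowerSeries in
/-- The expansion of `1 / (x - d)` in the powers of `x⁻¹`. -/
def resolvent (d : ℂ) : PowerSeries ℂ :=
  X * mk fun a => d ^ a

theorem resolvent_sub_resolvent (a b : ℂ) :
    resolvent a - resolvent b = PowerSeries.C (a - b) * (resolvent a * resolvent b) := by
  -- The resolvent is characterised by (1 - d x⁻¹) · resolvent = x⁻¹; the identity is then checked
  -- after clearing denominators.
  have key : ∀ d : ℂ, (1 - PowerSeries.C d * PowerSeries.X) * resolvent d = PowerSeries.X := by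
    intro d
    have h : (1 - PowerSeries.C d * PowerSeries.X) * PowerSeries.mk (fun a => d ^ a) = 1 := by
      ext n
      rw [sub_mul, one_mul, mul_assoc]
      rcases n with _ | n
      · simp
      · simp [PowerSeries.coeff_succ_X_mul, PowerSeries.coeff_one, pow_succ, mul_comm]
    rw [resolvent, mul_left_comm, h, mul_one]
  have hne : ∀ d : ℂ, (1 - PowerSeries.C d * PowerSeries.X) ≠ 0 := by
    intro d h
    simpa using congrArg PowerSeries.constantCoeff h
  apply mul_left_cancel₀ (mul_ne_zero (hne a) (hne b))
  have ha := key a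
  have hb := key b
  rw [map_sub]
  linear_combination ((1 - PowerSeries.C b * PowerSeries.X)
      - (PowerSeries.C a - PowerSeries.C b) * (1 - PowerSeries.C b * PowerSeries.X) * resolvent b)
      * ha
    - ((1 - PowerSeries.C a * PowerSeries.X)
      + (PowerSeries.C a - PowerSeries.C b) * PowerSeries.X) * hb

theorem coeff_zero_resolvent (d : ℂ) : PowerSeries.coeff 0 (resolvent d) = 0 := by
  simp [resolvent]

theorem coeff_succ_resolvent (d : ℂ) (a : ℕ) : PowerSeries.coeff (a + 1) (resolvent d) = d ^ a := by
  simp [resolvent, PowerSeries.coeff_succ_X_mul]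

theorem rescale_resolvent (d : ℂ) :
    PowerSeries.rescale (-1 : ℂ) (resolvent d) = -resolvent (-d) := by
  ext n
  rcases n with _ | n
  · rw [PowerSeries.coeff_rescale, map_neg, coeff_zero_resolvent, coeff_zero_resolvent]; simp
  · simp only [PowerSeries.coeff_rescale, coeff_succ_resolvent, map_neg, pow_succ, neg_pow d n]
    ring

variable {Y : Type*} {N : ℕ}

theorem funext_option_iff {f g : Option Y → Fin N} :
    f = g ↔ f none = g none ∧ (fun y => f (some y)) = fun y => g (some y) := by
  constructor
  · rintro rfl
    exact ⟨rfl, rfl⟩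
  · rintro ⟨h1, h2⟩
    funext o
    cases o with
    | none => exact h1
    | some y => exact congrFun h2 y

variable [Fintype Y] [DecidableEq Y]

theorem sum_option_fun {M : Type*} [AddCommMonoid M] (F : (Option Y → Fin N) → M) :
    ∑ h, F h = ∑ p : Fin N, ∑ h : Y → Fin N, F (fun o => o.elim p h) := by
  rw [← Fintype.sum_prod_type']
  refine Fintype.sum_equiv (Equiv.piOptionEquivProd (β := fun _ => Fin N)) _ _ fun h => ?_
  congr 1
  funext o
  cases o <;> rfl

variable (Y N) in
/-- Operators with matrix elements in `ℂ`, made to act on the tensors with an additional auxiliary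
factor `none`, with coefficients in the power series in `x⁻¹`. -/
def embed : Matrix (Y → Fin N) (Y → Fin N) ℂ →+*
    Matrix (Option Y → Fin N) (Option Y → Fin N) (PowerSeries ℂ) where
  toFun A := Matrix.of fun f g =>
    if f none = g none then PowerSeries.C (A (fun y => f (some y)) fun y => g (some y)) else 0
  map_one' := by
    ext1 f g
    simp only [Matrix.of_apply, Matrix.one_apply, funext_option_iff (f := f)]
    split_ifs <;> simp_all
  map_zero' := by
    ext1 f g
    simp
  map_add' A B := by
    ext1 f g
    simp only [Matrix.of_apply, Matrix.add_apply, map_add]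
    split_ifs <;> simp
  map_mul' A B := by
    ext1 f g
    simp only [Matrix.of_apply, Matrix.mul_apply, sum_option_fun, Option.elim]
    rw [Finset.sum_eq_single (f none)]
    · by_cases h : f none = g none
      · simp only [h, if_true, map_sum, map_mul]
      · simp only [h, if_true, if_false, mul_zero, Finset.sum_const_zero]
    · intro p _ hp
      simp [hp.symm]
    · simp

theorem embed_apply (A : Matrix (Y → Fin N) (Y → Fin N) ℂ) (f g : Option Y → Fin N) :
    embed Y N A f g
      = if f none = g none then PowerSeries.C (A (fun y => f (some y)) fun y => g (some y)) else 0 :=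
  rfl

theorem embed_smul (a : ℂ) (A : Matrix (Y → Fin N) (Y → Fin N) ℂ) :
    embed Y N (a • A) = PowerSeries.C a • embed Y N A := by
  ext1 f g
  simp only [embed_apply, Matrix.smul_apply, smul_eq_mul, map_mul]
  split_ifs <;> simp

theorem embed_swapMat (k l : Y) :
    embed Y N (swapMat ℂ N k l) = swapMat (PowerSeries ℂ) N (some k) (some l) := by
  ext1 f g
  have h : (g = f ∘ Equiv.swap (some k) (some l)) ↔
      f none = g none ∧ (fun y => g (some y)) = (fun y => f (some y)) ∘ Equiv.swap k l := by
    rw [funext_option_iff, eq_comm (a := g none)]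
    refine and_congr (by simp [Equiv.swap_apply_def]) (Eq.congr_right (funext fun y => ?_))
    simp only [Function.comp_apply, Equiv.swap_apply_def, Option.some.injEq]
    split_ifs <;> rfl
  simp only [embed_apply, swapMat, Matrix.of_apply, h]
  split_ifs <;> simp_all

theorem embed_contrMat (k l : Y) :
    embed Y N (contrMat ℂ N k l) = contrMat (PowerSeries ℂ) N (some k) (some l) := by
  ext1 f g
  have h : ∀ i, (g = Function.update (Function.update f (some k) i) (some l) i) ↔
      f none = g none ∧ (fun y => g (some y))
        = Function.update (Function.update (fun y => f (some y)) k i) l i := by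
    intro i
    rw [funext_option_iff, eq_comm (a := g none)]
    refine and_congr (by simp) (Eq.congr_right (funext fun y => ?_))
    simp only [Function.update_apply, Option.some.injEq]
  simp only [embed_apply, contrMat, Matrix.of_apply, h]
  by_cases h1 : f none = g none <;> by_cases h2 : f (some k) = f (some l) <;> simp [h1, h2]

variable (N) in
/-- `1 - P / (x - d)` for the auxiliary factor and the factor `k`. -/
def auxSwap (d : ℂ) (k : Y) : Matrix (Option Y → Fin N) (Option Y → Fin N) (PowerSeries ℂ) :=
  1 - resolvent d • swapMat (PowerSeries ℂ) N none (some k)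

variable (N) in
/-- `1 + Q / (x + d)` for the auxiliary factor and the factor `k`. -/
def auxContr (d : ℂ) (k : Y) : Matrix (Option Y → Fin N) (Option Y → Fin N) (PowerSeries ℂ) :=
  1 - (-resolvent (-d)) • contrMat (PowerSeries ℂ) N none (some k)

theorem embed_swapFactor (d : Y → ℂ) (k l : Y) :
    embed Y N (swapFactor N d k l)
      = 1 - PowerSeries.C (d k - d l)⁻¹ • swapMat (PowerSeries ℂ) N (some k) (some l) := by
  rw [swapFactor, map_sub, map_one, embed_smul, embed_swapMat]

theorem embed_contrFactor (d : Y → ℂ) (k l : Y) :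
    embed Y N (contrFactor N d k l)
      = 1 - PowerSeries.C (d k + d l)⁻¹ • contrMat (PowerSeries ℂ) N (some k) (some l) := by
  rw [contrFactor, map_sub, map_one, embed_smul, embed_contrMat]

/-- The generic statement: E first exchanges the row of swaps, then the row of contractions, and G
exchanges both rows at once. -/
theorem reflection_intertwining {d c : Y → ℂ} (hc : ∀ k, c k = d k + N / 2)
    (h1 : ∀ k l, k ≠ l → d k ≠ d l) (h2 : ∀ k l, k ≠ l → c k + c l ≠ 0) {L : List Y}
    (hL : L.Nodup) :
    embed Y N (nestedProd (contrFactor N c) L * nestedProd (swapFactor N d) L) *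
        ((L.reverse.map fun k => auxSwap N (d k) k).prod * (L.map fun k => auxContr N (d k) k).prod)
      = (L.reverse.map fun k => auxContr N (d k) k).prod * (L.map fun k => auxSwap N (d k) k).prod *
        embed Y N (nestedProd (contrFactor N c) L * nestedProd (swapFactor N d) L) := by
  have ns : ∀ k : Y, (none : Option Y) ≠ some k := fun k => by simp
  have ss : ∀ {k l : Y}, k ≠ l → some k ≠ some l := fun h => by simpa using h
  have hG := map_nestedProd (embed Y N).toMonoidHom (contrFactor N c) L
  have hE := map_nestedProd (embed Y N).toMonoidHom (swapFactor N d) L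
  simp only [RingHom.toMonoidHom_eq_coe, MonoidHom.coe_coe] at hG hE
  rw [map_mul, hG, hE]
  have e1 := nestedProd_mul_reverse (R := fun k l => embed Y N (swapFactor N d k l))
    (r := fun k => auxSwap N (d k) k) (fun k l hkl => by
      rw [embed_swapFactor]
      refine (yangBaxter_swap_swap_swap (ns k) (ns l) (ss hkl) ?_).symm
      have h := resolvent_sub_resolvent (d k) (d l)
      have h' : PowerSeries.C (d k - d l)⁻¹ * PowerSeries.C (d k - d l) = 1 := by
        rw [← map_mul, inv_mul_cancel₀ (sub_ne_zero.2 (h1 k l hkl)), map_one]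
      linear_combination PowerSeries.C (d k - d l)⁻¹ * h
        + resolvent (d k) * resolvent (d l) * h')
    (fun k l m hkl hkm hlm => by
      rw [embed_swapFactor]
      exact commute_one_sub_smul (commute_swapMat_swapMat (ns k).symm (ss hkm) (ns l).symm (ss hlm))
        _ _) hL
  have e2 := nestedProd_mul_forward (R := fun k l => embed Y N (swapFactor N d k l))
    (q := fun k => auxContr N (d k) k) (fun k l hkl => by
      rw [embed_swapFactor, swapMat_comm]
      refine (yangBaxter_contr_contr_swap (ns l) (ns k) (ss hkl.symm) ?_).symm
      have h := resolvent_sub_resolvent (-d k) (-d l)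
      rw [show -d k - -d l = -(d k - d l) by ring, map_neg] at h
      have h' : PowerSeries.C (d k - d l)⁻¹ * PowerSeries.C (d k - d l) = 1 := by
        rw [← map_mul, inv_mul_cancel₀ (sub_ne_zero.2 (h1 k l hkl)), map_one]
      linear_combination PowerSeries.C (d k - d l)⁻¹ * h
        - resolvent (-d k) * resolvent (-d l) * h')
    (fun k l m hkl hkm hlm => by
      rw [embed_swapFactor]
      exact commute_one_sub_smul
        (commute_swapMat_contrMat (ns k).symm (ss hkm) (ns l).symm (ss hlm)) _ _) hL
  -- The reciprocals of the three scalars are c_k + c_l, x - d_k and -(x + d_l). Their sum is N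
  -- because c = d + N/2.
  have hcond : ∀ k l, k ≠ l →
      PowerSeries.C (c k + c l)⁻¹ * resolvent (d k)
        + PowerSeries.C (c k + c l)⁻¹ * (-resolvent (-d l)) + resolvent (d k) * (-resolvent (-d l))
      = PowerSeries.C (c k + c l)⁻¹ * resolvent (d k) * (-resolvent (-d l)) * (N : PowerSeries ℂ) := by
    intro k l hkl
    have h := resolvent_sub_resolvent (d k) (-d l)
    have h' : PowerSeries.C (c k + c l)⁻¹ *
        (PowerSeries.C (d k - -d l) + (N : PowerSeries ℂ)) = 1 := by
      rw [← map_natCast (PowerSeries.C (R := ℂ)), ← map_add, ← map_mul,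
        show d k - -d l + N = c k + c l by rw [hc, hc]; ring, inv_mul_cancel₀ (h2 k l hkl), map_one]
    linear_combination PowerSeries.C (c k + c l)⁻¹ * h
      + resolvent (d k) * resolvent (-d l) * h'
  have e3 := nestedProd_mul_forward_mul_reverse
    (G := fun k l => embed Y N (contrFactor N c k l)) (r := fun k => auxSwap N (d k) k)
    (q := fun k => auxContr N (d k) k) 
    (fun k l hkl => by
      rw [embed_contrFactor]
      exact yangBaxter_contr_swap_contr (ss hkl) (ns k).symm (ns l).symm (hcond k l hkl))
    (fun k l hkl => by
      rw [embed_contrFactor, contrMat_comm, add_comm (c k)]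
      exact yangBaxter_contr_swap_contr (ss hkl.symm) (ns l).symm (ns k).symm
        (hcond l k hkl.symm))
    (fun k => commute_one_sub_smul (by
      rw [Commute, SemiconjBy, swapMat_mul_contrMat, contrMat_mul_swapMat (ns k)]) _ _)
    (fun k l m hkl hkm hlm => by
      rw [embed_contrFactor]
      exact commute_one_sub_smul
        (commute_swapMat_contrMat (ns k) (ns l) (ss hkm).symm (ss hlm).symm).symm _ _)
    (fun k l m hkl hkm hlm => by
      rw [embed_contrFactor]
      exact commute_one_sub_smul
        (commute_contrMat_contrMat (ns k).symm (ss hkm) (ns l).symm (ss hlm)) _ _) hL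
  generalize nestedProd (fun k l => embed Y N (contrFactor N c k l)) L = G at *
  generalize nestedProd (fun k l => embed Y N (swapFactor N d k l)) L = E at *
  generalize (L.reverse.map fun k => auxSwap N (d k) k).prod = r' at *
  generalize (L.map fun k => auxSwap N (d k) k).prod = r at *
  generalize (L.reverse.map fun k => auxContr N (d k) k).prod = q' at *
  generalize (L.map fun k => auxContr N (d k) k).prod = q at *
  calc G * E * (r' * q) = G * (E * r') * q := by simp only [mul_assoc]
    _ = G * r * (E * q) := by rw [e1]; simp only [mul_assoc]
    _ = G * (r * q') * E := by rw [e2]; simp only [mul_assoc]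
    _ = q' * r * (G * E) := by rw [e3]; simp only [mul_assoc]

end Auxiliary

/-! ## Matrix elements of monodromy operators -/

section Monodromy

variable {Y : Type*} {N : ℕ}

/-- The generating function of a family of operators, as an operator on the tensors with the
auxiliary factor. -/
def monodromy (t : ℕ → Fin N → Fin N → Matrix (Y → Fin N) (Y → Fin N) ℂ) :
    Matrix (Option Y → Fin N) (Option Y → Fin N) (PowerSeries ℂ) :=
  Matrix.of fun f g => PowerSeries.mk fun a =>
    t a (f none) (g none) (fun y => f (some y)) fun y => g (some y)

theorem monodromy_injective :
    Function.Injective (monodromy (Y := Y) (N := N)) := by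
  intro s t h
  funext a i j
  ext f g
  have := congrArg (PowerSeries.coeff a)
    (congrFun (congrFun h fun o => o.elim i f) fun o => o.elim j g)
  simpa [monodromy] using this

variable [Fintype Y] [DecidableEq Y]

/-- The operator acting in the auxiliary factor and in the factor `k`, with the matrix elements
`w a b i j`, where `a`, `b` are the indices of the factor `k` and `i`, `j` are auxiliary. -/
def siteMat (w : Fin N → Fin N → Matrix (Fin N) (Fin N) (PowerSeries ℂ)) (k : Y) :
    Matrix (Option Y → Fin N) (Option Y → Fin N) (PowerSeries ℂ) :=
  Matrix.of fun f g =>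
    if ∀ m, m ≠ k → f (some m) = g (some m) then w (f (some k)) (g (some k)) (f none) (g none)
    else 0

/-- Each physical site is touched once, so its two indices only select an N × N matrix; the
auxiliary indices are multiplied as matrices. -/
theorem prod_siteMat_apply (w : Y → Fin N → Fin N → Matrix (Fin N) (Fin N) (PowerSeries ℂ)) :
    ∀ {L : List Y}, L.Nodup → ∀ f g : Option Y → Fin N,
      (L.map fun k => siteMat (w k) k).prod f g
        = if ∀ m, m ∉ L → f (some m) = g (some m) then
            (L.map fun k => w k (f (some k)) (g (some k))).prod (f none) (g none) else 0
  | [], _, f, g => by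
    simp only [List.map_nil, List.prod_nil, Matrix.one_apply, funext_option_iff (f := f),
      funext_iff, List.not_mem_nil, not_false_eq_true, true_imp_iff]
    split_ifs <;> simp_all
  | k :: L, hL, f, g => by
    rw [List.nodup_cons] at hL
    have ih := prod_siteMat_apply w hL.2
    have hne : ∀ m ∈ L, m ≠ k := by rintro m hm rfl; exact hL.1 hm
    simp only [List.map_cons, List.prod_cons, Matrix.mul_apply, sum_option_fun, ih]
    simp only [siteMat, Matrix.of_apply, Option.elim]
    -- The only intermediate index that contributes has its final value at k and its initial values
    -- elsewhere.
    rw [Finset.sum_comm,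
      Finset.sum_eq_single (Function.update (fun y => f (some y)) k (g (some k)))]
    · have h1 : ∀ m, m ≠ k →
          f (some m) = Function.update (fun y => f (some y)) k (g (some k)) m := by
        intro m hm
        simp [hm]
      have h2 : (∀ m, m ∉ L → Function.update (fun y => f (some y)) k (g (some k)) m = g (some m))
          ↔ ∀ m, m ∉ k :: L → f (some m) = g (some m) := by
        simp only [Function.update_apply, List.mem_cons]
        grind
      have h3 : ∀ p, (L.map fun l =>
            w l (Function.update (fun y => f (some y)) k (g (some k)) l) (g (some l))).prod p (g none)
          = (L.map fun l => w l (f (some l)) (g (some l))).prod p (g none) := by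
        intro p
        rw [List.map_congr_left fun l hl => by rw [Function.update_of_ne (hne l hl)]]
      simp only [h2, h3, Function.update_self, eq_true h1, if_true]
      split_ifs <;> simp
    · intro h _ hh
      refine Finset.sum_eq_zero fun p _ => ?_
      by_contra hzero
      apply hh
      funext m
      have hz := mul_ne_zero_iff.1 hzero
      have a1 := (ite_ne_right_iff.1 hz.1).1
      have a2 := (ite_ne_right_iff.1 hz.2).1
      by_cases hm : m = k
      · subst hm
        simp [a2 m hL.1]
      · simp [hm, a1 m hm]
    · simp

/-- The matrix elements of `1 - P / (x - d)`. -/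
def evalEntry (d : ℂ) (a b : Fin N) : Matrix (Fin N) (Fin N) (PowerSeries ℂ) :=
  Matrix.of fun i j =>
    (if a = b ∧ i = j then 1 else 0) - if a = j ∧ i = b then resolvent d else 0

/-- The matrix elements of `1 + Q / (x + d)`. -/
def twistedEntry (d : ℂ) (a b : Fin N) : Matrix (Fin N) (Fin N) (PowerSeries ℂ) :=
  Matrix.of fun i j =>
    (if a = b ∧ i = j then 1 else 0) + if a = i ∧ j = b then resolvent (-d) else 0

theorem one_apply_option (k : Y) (f g : Option Y → Fin N) :
    (1 : Matrix (Option Y → Fin N) (Option Y → Fin N) (PowerSeries ℂ)) f g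
      = if ∀ m, m ≠ k → f (some m) = g (some m) then
          if f (some k) = g (some k) ∧ f none = g none then 1 else 0 else 0 := by
  rw [Matrix.one_apply, ← ite_and]
  congr 1
  rw [funext_option_iff, funext_iff, eq_iff_iff]
  constructor
  · rintro ⟨h1, h2⟩
    exact ⟨fun m _ => h2 m, h2 k, h1⟩
  · rintro ⟨h1, h2, h3⟩
    exact ⟨h3, fun m => if hm : m = k then hm ▸ h2 else h1 m hm⟩

theorem auxSwap_eq_siteMat (d : ℂ) (k : Y) : auxSwap N d k = siteMat (evalEntry d) k := by
  ext1 f g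
  have h : (g = f ∘ Equiv.swap none (some k)) ↔ (∀ m, m ≠ k → f (some m) = g (some m)) ∧
      f (some k) = g none ∧ f none = g (some k) := by
    rw [funext_iff, Option.forall]
    simp only [Function.comp_apply, Equiv.swap_apply_left]
    constructor
    · rintro ⟨h1, h2⟩
      refine ⟨fun m hm => ?_, h1.symm, ?_⟩
      · rw [h2, Equiv.swap_apply_of_ne_of_ne (by simp) (by simpa using hm)]
      · rw [h2, Equiv.swap_apply_right]
    · rintro ⟨h1, h2, h3⟩
      refine ⟨h2.symm, fun m => ?_⟩
      by_cases hm : m = k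
      · subst hm
        rw [Equiv.swap_apply_right, h3]
      · rw [Equiv.swap_apply_of_ne_of_ne (by simp) (by simpa using hm), h1 m hm]
  rw [auxSwap, Matrix.sub_apply, one_apply_option k, Matrix.smul_apply, swapMat, Matrix.of_apply,
    siteMat, Matrix.of_apply, evalEntry, Matrix.of_apply]
  simp only [h]
  by_cases h1 : ∀ m, m ≠ k → f (some m) = g (some m)
  · rw [if_pos h1, if_pos h1]
    simp only [eq_true h1, true_and, smul_eq_mul, mul_ite, mul_one, mul_zero]
  · rw [if_neg h1, if_neg h1, if_neg (fun h => h1 h.1), smul_zero, sub_zero]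

theorem auxContr_eq_siteMat (d : ℂ) (k : Y) : auxContr N d k = siteMat (twistedEntry d) k := by
  ext1 f g
  have h : ∀ i, (g = Function.update (Function.update f none i) (some k) i) ↔
      (∀ m, m ≠ k → f (some m) = g (some m)) ∧ g none = i ∧ g (some k) = i := by
    intro i
    rw [funext_iff, Option.forall]
    simp only [Function.update_apply, Option.some.injEq]
    grind
  rw [auxContr, Matrix.sub_apply, one_apply_option k, Matrix.smul_apply, contrMat, Matrix.of_apply,
    siteMat, Matrix.of_apply, twistedEntry, Matrix.of_apply]
  simp only [h]
  by_cases h1 : ∀ m, m ≠ k → f (some m) = g (some m)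
  · rw [if_pos h1, if_pos h1]
    have h2 : (∑ i : Fin N, if (∀ m, m ≠ k → f (some m) = g (some m)) ∧ g none = i ∧ g (some k) = i
        then (1 : PowerSeries ℂ) else 0) = if g none = g (some k) then 1 else 0 := by
      rw [Finset.sum_eq_single (g none)]
      · simp only [eq_true h1, true_and, eq_comm (a := g (some k))]
      · intro i _ hi
        rw [if_neg]
        rintro ⟨-, h, -⟩
        exact hi h.symm
      · simp
    rw [h2, neg_smul, sub_neg_eq_add, smul_eq_mul, ← ite_and, mul_ite, mul_one, mul_zero]
    simp only [eq_comm (a := f none) (b := f (some k))]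
  · rw [if_neg h1, if_neg h1]
    simp [h1]

/-- Partial transposition exchanges P and Q, and x -> -x sends 1/(x + d) to -1/(x - d). -/
theorem evalEntry_transpose (d : ℂ) (a b : Fin N) :
    ((twistedEntry d a b).map (PowerSeries.rescale (-1 : ℂ))).transpose = evalEntry d a b := by
  ext1 i j
  simp only [twistedEntry, evalEntry, Matrix.transpose_apply, Matrix.map_apply, Matrix.of_apply,
    map_add, apply_ite (PowerSeries.rescale (-1 : ℂ)), map_one, map_zero, rescale_resolvent, neg_neg,
    eq_comm (a := j) (b := i)]
  split_ifs <;> simp [sub_eq_add_neg]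

theorem twistedEntry_transpose (d : ℂ) (a b : Fin N) :
    ((evalEntry d a b).map (PowerSeries.rescale (-1 : ℂ))).transpose = twistedEntry d a b := by
  ext1 i j
  simp only [twistedEntry, evalEntry, Matrix.transpose_apply, Matrix.map_apply, Matrix.of_apply,
    map_sub, apply_ite (PowerSeries.rescale (-1 : ℂ)), map_one, map_zero, rescale_resolvent,
    eq_comm (a := j) (b := i)]
  split_ifs <;> simp

theorem monodromy_mul (s t : ℕ → Fin N → Fin N → Matrix (Y → Fin N) (Y → Fin N) ℂ) :
    monodromy s * monodromy t = monodromy (mulFamily s t) := by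
  ext f g a
  simp only [Matrix.mul_apply, sum_option_fun, monodromy, Matrix.of_apply, mulFamily, map_sum,
    PowerSeries.coeff_mul, PowerSeries.coeff_mk, Matrix.sum_apply, Option.elim]
  refine Finset.sum_congr rfl fun p _ => ?_
  rw [Finset.sum_comm]

theorem monodromy_mul_embed (t : ℕ → Fin N → Fin N → Matrix (Y → Fin N) (Y → Fin N) ℂ)
    (A : Matrix (Y → Fin N) (Y → Fin N) ℂ) :
    monodromy t * embed Y N A = monodromy fun a i j => t a i j * A := by
  ext f g a
  simp only [Matrix.mul_apply, sum_option_fun, monodromy, Matrix.of_apply, embed_apply, map_sum,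
    PowerSeries.coeff_mk, Option.elim]
  rw [Finset.sum_eq_single (g none)]
  · simp
  · intro p _ hp
    simp [hp]
  · simp

theorem embed_mul_monodromy (t : ℕ → Fin N → Fin N → Matrix (Y → Fin N) (Y → Fin N) ℂ)
    (A : Matrix (Y → Fin N) (Y → Fin N) ℂ) :
    embed Y N A * monodromy t = monodromy fun a i j => A * t a i j := by
  ext f g a
  simp only [Matrix.mul_apply, sum_option_fun, monodromy, Matrix.of_apply, embed_apply, map_sum,
    PowerSeries.coeff_mk, Option.elim]
  rw [Finset.sum_eq_single (f none)]
  · simp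
  · intro p _ hp
    simp [hp.symm]
  · simp

end Monodromy

/-! ## Matrix elements of operators on tensor powers -/

section Bridge

variable {N n : ℕ}

variable (N n) in
/-- The standard basis of `(ℂ^N)^{⊗ n}`. -/
def tensBasis : Module.Basis (Fin n → Fin N) ℂ (Tens N n) :=
  Basis.piTensorProduct fun _ => Pi.basisFun ℂ (Fin N)

variable (N n) in
/-- The matrix of an operator in the standard basis. -/
def tensMat : Module.End ℂ (Tens N n) ≃ₐ[ℂ] Matrix (Fin n → Fin N) (Fin n → Fin N) ℂ :=
  LinearMap.toMatrixAlgEquiv (tensBasis N n)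

theorem tensMat_apply (A : Module.End ℂ (Tens N n)) (f g : Fin n → Fin N) :
    tensMat N n A f g = (tensBasis N n).repr (A (tensBasis N n g)) f := by
  rw [tensMat, LinearMap.toMatrixAlgEquiv_apply]

theorem tensBasis_apply (g : Fin n → Fin N) :
    tensBasis N n g = PiTensorProduct.tprod ℂ fun k => Pi.single (g k) (1 : ℂ) := by
  simp [tensBasis]

theorem tensBasis_repr_tprod (u : Fin n → Vec N) (f : Fin n → Fin N) :
    (tensBasis N n).repr (PiTensorProduct.tprod ℂ u) f = ∏ k, u k (f k) := by
  simp [tensBasis, Basis.piTensorProduct_repr_tprod_apply]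

theorem tensMat_P (k l : Fin n) : tensMat N n (P N k l) = swapMat ℂ N k l := by
  ext f g
  rw [tensMat_apply, tensBasis_apply, P, LinearEquiv.coe_coe, PiTensorProduct.reindex_tprod,
    tensBasis_repr_tprod, swapMat, Matrix.of_apply, Equiv.symm_swap]
  simp only [Pi.single_apply, Finset.prod_ite_zero, Finset.prod_const_one, Finset.mem_univ,
    true_imp_iff]
  congr 1
  rw [funext_iff, eq_iff_iff]
  constructor
  · intro h x
    simpa using (h (Equiv.swap k l x)).symm
  · intro h x
    simpa using (h (Equiv.swap k l x)).symm

theorem site_tprod (k : Fin n) (A : Module.End ℂ (Vec N)) (u : Fin n → Vec N) :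
    site N k A (PiTensorProduct.tprod ℂ u)
      = PiTensorProduct.tprod ℂ (Function.update u k (A (u k))) := by
  rw [site, PiTensorProduct.map_tprod]
  congr 1
  funext m
  by_cases h : m = k
  · subst h; simp
  · simp [h]

theorem tensMat_Q {k l : Fin n} (hkl : k ≠ l) : tensMat N n (Q N k l) = contrMat ℂ N k l := by
  have key : ∀ (i j : Fin N) (f g : Fin n → Fin N),
      tensMat N n (site N k (Matrix.toLin' (Matrix.single i j 1))
        * site N l (Matrix.toLin' (Matrix.single i j 1))) f g
      = if (f k = i ∧ f l = i) ∧ (g k = j ∧ g l = j) ∧ ∀ m, m ≠ k → m ≠ l → f m = g m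
          then 1 else 0 := by
    intro i j f g
    rw [tensMat_apply, tensBasis_apply, Module.End.mul_apply, site_tprod, site_tprod,
      tensBasis_repr_tprod]
    have h1 : ∀ (u : Fin N), Matrix.toLin' (Matrix.single i j (1 : ℂ)) (Pi.single u 1)
        = fun v => if v = i ∧ u = j then (1 : ℂ) else 0 := by
      intro u
      ext v
      simp [Matrix.single_apply, eq_comm]
    rw [Function.update_of_ne hkl, h1, h1]
    have h2 : ∀ m, Function.update (Function.update
        (fun k => (Pi.single (g k) (1 : ℂ) : Vec N)) l fun v => if v = i ∧ g l = j then (1 : ℂ) else 0)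
        k (fun v => if v = i ∧ g k = j then (1 : ℂ) else 0) m (f m)
        = if (m = k → f k = i ∧ g k = j) ∧ (m = l → f l = i ∧ g l = j) ∧
            (m ≠ k → m ≠ l → f m = g m) then 1 else 0 := by
      intro m
      by_cases hk : m = k
      · subst hk; simp [hkl]
      · by_cases hl : m = l
        · subst hl; simp [hk]
        · simp [hk, hl, Pi.single_apply]
    simp only [h2, Finset.prod_ite_zero, Finset.prod_const_one, Finset.mem_univ, true_imp_iff]
    congr 1
    rw [eq_iff_iff]
    constructor
    · intro h
      exact ⟨⟨((h k).1 rfl).1, ((h l).2.1 rfl).1⟩, ⟨((h k).1 rfl).2, ((h l).2.1 rfl).2⟩,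
        fun m => (h m).2.2⟩
    · rintro ⟨⟨a1, a2⟩, ⟨b1, b2⟩, h⟩ m
      exact ⟨fun _ => ⟨a1, b1⟩, fun _ => ⟨a2, b2⟩, h m⟩
  ext f g
  rw [Q, map_sum, Matrix.sum_apply]
  simp only [map_sum, Matrix.sum_apply, key, contrMat, Matrix.of_apply]
  by_cases hf : f k = f l
  · rw [if_pos hf, Finset.sum_eq_single (f k)]
    · refine Finset.sum_congr rfl fun j _ => ?_
      congr 1
      rw [funext_iff, eq_iff_iff]
      simp only [Function.update_apply]
      grind
    · intro i _ hi
      simp [hi.symm]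
    · simp
  · rw [if_neg hf]
    refine Finset.sum_eq_zero fun i _ => Finset.sum_eq_zero fun j _ => ?_
    rw [if_neg]
    rintro ⟨⟨a1, a2⟩, -⟩
    exact hf (a1.trans a2.symm)

theorem tensSucc_tprod (u : Fin n → Vec N) (v : Vec N) :
    tensSucc N n (PiTensorProduct.tprod ℂ u ⊗ₜ v)
      = PiTensorProduct.tprod ℂ (Fin.snoc (α := fun _ => Vec N) u v) := by
  rw [tensSucc, LinearEquiv.trans_apply, TensorProduct.congr_tmul, LinearEquiv.refl_apply,
    PiTensorProduct.subsingletonEquiv_symm_apply]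
  refine (TensorPower.tprod_mul_tprod ℂ u _).trans ?_
  congr 1
  rw [Fin.append_right_eq_snoc]
  simp

theorem tensBasis_repr_tensSucc (x : Tens N n) (v : Vec N) (f : Fin (n + 1) → Fin N) :
    (tensBasis N (n + 1)).repr (tensSucc N n (x ⊗ₜ v)) f
      = (tensBasis N n).repr x (fun k => f k.castSucc) * v (f (Fin.last n)) := by
  induction x using PiTensorProduct.induction_on with
  | smul_tprod r u =>
    rw [← TensorProduct.smul_tmul', map_smul, map_smul, map_smul, tensSucc_tprod]
    simp only [Finsupp.smul_apply, tensBasis_repr_tprod, Fin.prod_univ_castSucc, Fin.snoc_castSucc,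
      Fin.snoc_last, smul_eq_mul, mul_assoc]
  | add x y hx hy =>
    rw [TensorProduct.add_tmul, map_add, map_add, map_add, Finsupp.add_apply, Finsupp.add_apply,
      hx, hy, add_mul]

theorem tensSucc_symm_tensBasis (g : Fin (n + 1) → Fin N) :
    (tensSucc N n).symm (tensBasis N (n + 1) g)
      = tensBasis N n (fun k => g k.castSucc) ⊗ₜ Pi.single (g (Fin.last n)) 1 := by
  rw [LinearEquiv.symm_apply_eq, tensBasis_apply, tensBasis_apply, tensSucc_tprod]
  congr 1
  funext k
  refine Fin.lastCases ?_ (fun k => ?_) k <;> simp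

/-- The coproduct is matrix multiplication in the auxiliary indices, so each new tensor factor
appends one matrix on the right; the counit gives the empty product. -/
theorem tensMat_tensorPowerRep_T :
    ∀ {n : ℕ} (ρ : Fin n → (Yangian N →ₐ[ℂ] Module.End ℂ (Vec N)))
      (w : Fin n → Fin N → Fin N → Matrix (Fin N) (Fin N) (PowerSeries ℂ)),
      (∀ k a i j c b, ρ k (T a i j) (Pi.single b 1) c = PowerSeries.coeff a (w k c b i j)) →
      ∀ a i j f g, tensMat N n (tensorPowerRep N n ρ (T a i j)) f g
        = PowerSeries.coeff a (((List.finRange n).map fun k => w k (f k) (g k)).prod i j)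
  | 0, ρ, w, _, a, i, j, f, g => by
    rw [tensMat_apply]
    simp only [tensorPowerRep, AlgHom.comp_apply, counit, yLift_T, Algebra.ofId_apply,
      Module.algebraMap_end_apply, map_smul, Finsupp.smul_apply, Module.Basis.repr_self,
      List.finRange_zero, List.map_nil, List.prod_nil, Subsingleton.elim f g, Finsupp.single_eq_same,
      smul_eq_mul, mul_one, Matrix.one_apply, apply_ite (PowerSeries.coeff a), map_zero,
      PowerSeries.coeff_one]
    split_ifs <;> simp_all
  | n + 1, ρ, w, h, a, i, j, f, g => by
    have ih := tensMat_tensorPowerRep_T (fun k => ρ k.castSucc) (fun k => w k.castSucc)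
      (fun k => h k.castSucc)
    have hconj : ∀ (A : Module.End ℂ (Tens N n ⊗[ℂ] Vec N)) (x : Tens N (n + 1)),
        ((tensSucc N n).conjAlgEquiv ℂ).toAlgHom A x = tensSucc N n (A ((tensSucc N n).symm x)) :=
      fun _ _ => rfl
    have hmul : ((List.finRange (n + 1)).map fun k => w k (f k) (g k)).prod i j
        = ∑ k, ((List.finRange n).map fun k => w k.castSucc (f k.castSucc) (g k.castSucc)).prod i k
          * w (Fin.last n) (f (Fin.last n)) (g (Fin.last n)) k j := by
      rw [List.finRange_succ_last, List.map_append, List.prod_append, List.map_map,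
        Matrix.mul_apply]
      simp [Function.comp_def]
    rw [tensMat_apply, hmul, map_sum]
    simp only [tensorPowerRep, AlgHom.comp_apply, tensorRep, coproduct_T, map_sum, hconj,
      tensSucc_symm_tensBasis, LinearMap.sum_apply, Finsupp.finsetSum_apply,
      Algebra.TensorProduct.map_tmul, Module.endTensorEndAlgHom_apply,
      TensorProduct.AlgebraTensorModule.map_tmul, tensBasis_repr_tensSucc, h, PowerSeries.coeff_mul]
    refine Finset.sum_congr rfl fun k _ => Finset.sum_congr rfl fun p _ => ?_
    have := ih p.1 i k (fun k => f k.castSucc) (fun k => g k.castSucc)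
    rw [tensMat_apply] at this
    rw [this]

/-! ### The evaluation modules in the standard basis -/

theorem stdRep_uE (i j : Fin N) (b c : Fin N) :
    stdRep N (uE i j) (Pi.single b 1) c = if c = i ∧ b = j then 1 else 0 := by
  have : stdRep N (uE i j) = Matrix.toLin' (Matrix.single i j (1 : ℂ)) := by
    rw [stdRep, uE, UniversalEnvelopingAlgebra.lift_ι_apply]
    rfl
  rw [this]
  simp [Matrix.single_apply, eq_comm]

theorem sigma_uE (i j : Fin N) : sigma N (uE i j) = -uE j i := by
  have h : sigmaLie N (Matrix.single i j (1 : ℂ)) = -Matrix.single j i (1 : ℂ) :=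
    congrArg Neg.neg (Matrix.transpose_single i j (1 : ℂ))
  rw [sigma, uE, UniversalEnvelopingAlgebra.lift_ι_apply, uE, ← map_neg, ← h]
  rfl

/-- The evaluation homomorphism kills the coefficients of degree at least 2, leaving only the term
with binomial coefficient (a choose 0). -/
theorem alpha_tau_T (z : ℂ) (a : ℕ) (i j : Fin N) :
    alpha N (tau N z (T (a + 1) i j)) = -(z ^ a • uE j i) := by
  rw [tau, yLift_T, shiftFamily, map_sum, Finset.sum_eq_single 0]
  · simp [alpha, evalFamily]
  · intro s _ hs
    obtain ⟨s, rfl⟩ := Nat.exists_eq_succ_of_ne_zero hs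
    simp [alpha, evalFamily]
  · simp

theorem tau_T_zero (z : ℂ) (i j : Fin N) :
    tau N z (T 0 i j) = if i = j then 1 else 0 := by
  rw [tau, yLift_T, shiftFamily, (isYangianFamily_T N).zero]

theorem evalRep_T (z : ℂ) (a : ℕ) (i j c b : Fin N) :
    evalRep N z (T a i j) (Pi.single b 1) c = PowerSeries.coeff a (evalEntry z c b i j) := by
  rw [evalEntry, Matrix.of_apply, evalRep, AlgHom.comp_apply, AlgHom.comp_apply, map_sub,
    apply_ite (PowerSeries.coeff a), apply_ite (PowerSeries.coeff a), map_zero, PowerSeries.coeff_one]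
  rcases a with _ | a
  · rw [tau_T_zero, coeff_zero_resolvent]
    by_cases hij : i = j <;> simp [hij, Pi.single_apply]
  · rw [alpha_tau_T, map_neg, map_smul, LinearMap.neg_apply, LinearMap.smul_apply, Pi.neg_apply,
      Pi.smul_apply, stdRep_uE, coeff_succ_resolvent]
    simp [eq_comm]

theorem twistedEvalRep_T (z : ℂ) (a : ℕ) (i j c b : Fin N) :
    twistedEvalRep N z (T a i j) (Pi.single b 1) c
      = PowerSeries.coeff a (twistedEntry z c b i j) := by
  rw [twistedEntry, Matrix.of_apply, twistedEvalRep, AlgHom.comp_apply, AlgHom.comp_apply,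
    AlgHom.comp_apply, map_add, apply_ite (PowerSeries.coeff a), apply_ite (PowerSeries.coeff a),
    map_zero, PowerSeries.coeff_one]
  rcases a with _ | a
  · rw [tau_T_zero, coeff_zero_resolvent]
    by_cases hij : i = j <;> simp [hij, Pi.single_apply]
  · rw [alpha_tau_T, map_neg, map_smul, sigma_uE, smul_neg, neg_neg, map_smul,
      LinearMap.smul_apply, Pi.smul_apply, stdRep_uE, coeff_succ_resolvent]
    simp [eq_comm]

theorem monodromy_eq_prod_siteMat (ρ : Fin n → (Yangian N →ₐ[ℂ] Module.End ℂ (Vec N)))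
    (w : Fin n → Fin N → Fin N → Matrix (Fin N) (Fin N) (PowerSeries ℂ))
    (h : ∀ k a i j c b, ρ k (T a i j) (Pi.single b 1) c = PowerSeries.coeff a (w k c b i j)) :
    monodromy (fun a i j => tensMat N n (tensorPowerRep N n ρ (T a i j)))
      = ((List.finRange n).map fun k => siteMat (w k) k).prod := by
  ext f g a
  rw [prod_siteMat_apply w (List.nodup_finRange n), if_pos (by simp), monodromy, Matrix.of_apply,
    PowerSeries.coeff_mk, tensMat_tensorPowerRep_T ρ w h]

/-- Matrix entries are commuting power series, so transposing the auxiliary product reverses the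
order of the sites. The sign is the substitution x -> -x. -/
theorem monodromy_transpose_eq_prod_siteMat
    (ρ : Fin n → (Yangian N →ₐ[ℂ] Module.End ℂ (Vec N)))
    (w : Fin n → Fin N → Fin N → Matrix (Fin N) (Fin N) (PowerSeries ℂ))
    (h : ∀ k a i j c b, ρ k (T a i j) (Pi.single b 1) c = PowerSeries.coeff a (w k c b i j)) :
    monodromy (fun a i j => (-1 : ℂ) ^ a • tensMat N n (tensorPowerRep N n ρ (T a j i)))
      = ((List.finRange n).reverse.map fun k =>
          siteMat (fun c b => ((w k c b).map (PowerSeries.rescale (-1 : ℂ))).transpose) k).prod := by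
  ext f g a
  rw [prod_siteMat_apply (fun k c b => ((w k c b).map (PowerSeries.rescale (-1 : ℂ))).transpose)
      (List.nodup_reverse.2 (List.nodup_finRange n)), if_pos (by simp), monodromy, Matrix.of_apply,
    PowerSeries.coeff_mk, Matrix.smul_apply, tensMat_tensorPowerRep_T ρ w h]
  have h1 : ((List.finRange n).reverse.map fun k =>
        ((w k (f (some k)) (g (some k))).map (PowerSeries.rescale (-1 : ℂ))).transpose).prod
      = ((((List.finRange n).map fun k => w k (f (some k)) (g (some k))).prod).map
          (PowerSeries.rescale (-1 : ℂ))).transpose := by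
    have h2 := map_list_prod (PowerSeries.rescale (-1 : ℂ)).mapMatrix
      ((List.finRange n).map fun k => w k (f (some k)) (g (some k)))
    rw [RingHom.mapMatrix_apply] at h2
    rw [h2, Matrix.transpose_list_prod, List.map_map, List.map_map, ← List.map_reverse]
    rfl
  rw [h1, Matrix.transpose_apply, Matrix.map_apply, PowerSeries.coeff_rescale, smul_eq_mul]

end Bridge

/-! ## Combinatorics of the column tableau -/

section ColumnTableau

variable {la mu : YoungDiagram}

theorem mem_skewBoxes (i j : ℕ) :
    toLex (j, i) ∈ skewBoxes la mu ↔ (i, j) ∈ la ∧ (i, j) ∉ mu := by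
  simp only [skewBoxes, Finset.mem_image, Finset.mem_sdiff, YoungDiagram.mem_cells, Prod.exists]
  constructor
  · rintro ⟨a, b, h, hab⟩
    obtain ⟨rfl, rfl⟩ : b = j ∧ a = i := by simpa using hab
    exact h
  · intro h
    exact ⟨i, j, h, rfl⟩

theorem row_col_mem (k : Fin (size la mu)) :
    (row la mu k, col la mu k) ∈ la ∧ (row la mu k, col la mu k) ∉ mu :=
  (mem_skewBoxes _ _).1 (Finset.orderEmbOfFin_mem (skewBoxes la mu) rfl k)

theorem exists_row_col {i j : ℕ} (h : (i, j) ∈ la) (h' : (i, j) ∉ mu) :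
    ∃ k : Fin (size la mu), row la mu k = i ∧ col la mu k = j := by
  have h1 : toLex (j, i) ∈ Set.range ((skewBoxes la mu).orderEmbOfFin rfl) := by
    rw [Finset.range_orderEmbOfFin]
    exact (mem_skewBoxes i j).2 ⟨h, h'⟩
  obtain ⟨k, hk⟩ := h1
  exact ⟨k, congrArg (fun x => (ofLex x).2) hk, congrArg (fun x => (ofLex x).1) hk⟩

theorem lt_iff_col_row (k l : Fin (size la mu)) : k < l ↔
    col la mu k < col la mu l ∨ col la mu k = col la mu l ∧ row la mu k < row la mu l := by
  rw [← (box la mu).lt_iff_lt, Prod.Lex.lt_iff]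
  rfl

theorem col_mono {k l : Fin (size la mu)} (h : k ≤ l) : col la mu k ≤ col la mu l := by
  rcases h.eq_or_lt with rfl | h
  · exact le_rfl
  · rcases (lt_iff_col_row k l).1 h with h | h
    · exact h.le
    · exact h.1.le

/-- A column of a skew diagram has no gaps: a missing row between l and m would be a box filled with
a number strictly between theirs. -/
theorem row_eq_row_add_one {l m : Fin (size la mu)} (h : (l : ℕ) + 1 = m)
    (hcol : col la mu l = col la mu m) : row la mu m = row la mu l + 1 := by
  have hlm : l < m := by rw [Fin.lt_def]; omega
  have hr : row la mu l < row la mu m := by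
    rcases (lt_iff_col_row l m).1 hlm with h | h
    · omega
    · exact h.2
  by_contra hne
  have hm := row_col_mem m
  have hl := row_col_mem l
  obtain ⟨p, hp1, hp2⟩ := exists_row_col (la := la) (mu := mu) (i := row la mu l + 1)
    (j := col la mu m) (la.up_left_mem hr le_rfl hm.1) (fun hmu => hl.2
      (mu.up_left_mem (Nat.le_succ _) hcol.le hmu))
  have h1 : l < p := (lt_iff_col_row l p).2 (Or.inr ⟨by omega, by omega⟩)
  have h2 : p < m := (lt_iff_col_row p m).2 (Or.inr ⟨by omega, by omega⟩)
  rw [Fin.lt_def] at h1 h2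
  omega

/-- If l lies further down the diagonal of k, the box just above l is in the outer diagram because l
is. It is weakly below and to the right of k, hence outside the inner one. -/
theorem exists_pred_of_content_eq {k l : Fin (size la mu)} (h : k < l)
    (hc : content la mu k = content la mu l) :
    ∃ p, k < p ∧ p < l ∧ col la mu p = col la mu l := by
  have hc' : col la mu k + row la mu l = col la mu l + row la mu k := by
    have : (col la mu k : ℂ) + row la mu l = col la mu l + row la mu k := by
      simp only [content] at hc
      linear_combination hc
    exact_mod_cast this
  have hcol : col la mu k < col la mu l := by
    rcases (lt_iff_col_row k l).1 h with h | h
    · exact h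
    · omega
  have hk := row_col_mem k
  have hl := row_col_mem l
  obtain ⟨p, hp1, hp2⟩ := exists_row_col (la := la) (mu := mu) (i := row la mu l - 1)
    (j := col la mu l) (la.up_left_mem (Nat.sub_le _ _) le_rfl hl.1) (fun hmu => hk.2
      (mu.up_left_mem (by omega) hcol.le hmu))
  exact ⟨p, (lt_iff_col_row k p).2 (Or.inl (by omega)),
    (lt_iff_col_row p l).2 (Or.inr ⟨hp2, by omega⟩), hp2⟩

theorem val_eq_length_of_finRange_eq {n : ℕ} {L₁ L₂ : List (Fin n)} {k : Fin n}
    (h : List.finRange n = L₁ ++ k :: L₂) : (k : ℕ) = L₁.length := by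
  have h1 : (List.finRange n)[L₁.length]? = some k := by rw [h]; simp
  rw [List.getElem?_eq_some_iff] at h1
  obtain ⟨h2, h3⟩ := h1
  rw [← h3]
  simp

theorem colStep_finRange {c : Fin (size la mu) → ℂ} (hc : ∀ k l, col la mu k = col la mu l →
      c k - c l = content la mu k - content la mu l) :
    ColStep (col la mu) c (List.finRange (size la mu)) := by
  intro L₁ l m L₂ h hcol
  have h1 := val_eq_length_of_finRange_eq h
  have h2 := val_eq_length_of_finRange_eq (L₁ := L₁ ++ [l]) (k := m) (L₂ := L₂) (by simpa using h)
  have h3 := row_eq_row_add_one (l := l) (m := m) (by rw [h1, h2]; simp) hcol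
  rw [hc l m hcol, content, content, hcol, h3]
  push_cast
  ring

theorem diagonalPred_finRange :
    DiagonalPred (col la mu) (content la mu) (List.finRange (size la mu)) := by
  intro L₁ k L₂ l L₃ h hc
  have h1 := val_eq_length_of_finRange_eq h
  have h2 := val_eq_length_of_finRange_eq (L₁ := L₁ ++ k :: L₂) (k := l) (L₂ := L₃)
    (by simpa using h)
  simp only [List.length_append, List.length_cons] at h2
  obtain ⟨p, hp1, hp2, hp3⟩ := exists_pred_of_content_eq (k := k) (l := l)
    (by rw [Fin.lt_def]; omega) hc
  rw [Fin.lt_def] at hp1 hp2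
  rcases List.eq_nil_or_concat L₂ with rfl | ⟨L₂', q, rfl⟩
  · simp at h2
    omega
  · refine ⟨L₂', q, by simp, ?_⟩
    have h3 := val_eq_length_of_finRange_eq (L₁ := L₁ ++ k :: L₂') (k := q) (L₂ := l :: L₃)
      (by simpa using h)
    simp only [List.length_append, List.length_cons, List.concat_eq_append, List.length_nil]
      at h2 h3
    have a1 : col la mu p ≤ col la mu q := col_mono (by rw [Fin.le_def]; omega)
    have a2 : col la mu q ≤ col la mu l := col_mono (by rw [Fin.le_def]; omega)
    omega

/-- With rows and columns counted from 0, the two rows sum to at most N + M - 2, while two different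
columns sum to at least 1. -/
theorem content_add_content_ne_zero {N M : ℕ} (hla : la.colLen 0 + la.colLen 1 ≤ N + M)
    {k l : Fin (size la mu)} (h : col la mu k ≠ col la mu l) :
    content la mu k + content la mu l + N + M - 1 ≠ 0 := by
  have hk := YoungDiagram.mem_iff_lt_colLen.1 (row_col_mem k).1
  have hl := YoungDiagram.mem_iff_lt_colLen.1 (row_col_mem l).1
  have key : row la mu k + row la mu l + 1 < col la mu k + col la mu l + N + M := by
    rcases Nat.lt_or_gt_of_ne h with h | h
    · have h1 := la.colLen_anti 0 (col la mu k) (Nat.zero_le _)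
      have h2 := la.colLen_anti 1 (col la mu l) (by omega)
      omega
    · have h1 := la.colLen_anti 0 (col la mu l) (Nat.zero_le _)
      have h2 := la.colLen_anti 1 (col la mu k) (by omega)
      omega
  intro h0
  have : (col la mu k : ℂ) + col la mu l + N + M = row la mu k + row la mu l + 1 := by
    simp only [content] at h0
    linear_combination h0
  have : col la mu k + col la mu l + N + M = row la mu k + row la mu l + 1 := by
    exact_mod_cast this
  omega

theorem content_sub_content_ne_zero {k l : Fin (size la mu)} (h : k < l)
    (hcol : col la mu k = col la mu l) : content la mu k - content la mu l ≠ 0 := by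
  have hr : row la mu k < row la mu l := by
    rcases (lt_iff_col_row k l).1 h with h | h
    · omega
    · exact h.2
  intro h0
  have : (row la mu l : ℂ) = row la mu k := by
    simp only [content, hcol] at h0
    linear_combination h0
  have : row la mu l = row la mu k := by exact_mod_cast this
  omega

end ColumnTableau

/-! ## The fusion value and the intertwining property -/

section Main

variable {la mu : YoungDiagram} {N M : ℕ}

theorem prod_pairs {n : ℕ} {B : Type*} [Monoid B] (f : Fin n → Fin n → B) :
    ((pairs n).map fun p => f p.1 p.2).prod = nestedProd f (List.finRange n) :=
  prod_filter_product f (List.finRange n) [] (List.pairwise_lt_finRange n)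

theorem tensMat_one_sub_smul {n : ℕ} (a : ℂ) (A : Module.End ℂ (Tens N n)) :
    tensMat N n (1 - a • A) = 1 - a • tensMat N n A := by
  have h := map_sub (tensMat N n) 1 (a • A)
  rw [map_one, map_smul] at h
  exact h

theorem tensMat_fusionProduct (t : Fin (size la mu) → ℂ) :
    tensMat N _ (fusionProduct la mu N t)
      = nestedProd (swapFactor N fun k => content la mu k + t k) (List.finRange _) := by
  rw [fusionProduct, map_list_prod, List.map_map, ← prod_pairs]
  congr 1
  refine List.map_congr_left fun p _ => ?_
  refine (tensMat_one_sub_smul _ _).trans ?_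
  rw [tensMat_P, swapFactor]
  congr 3
  ring

theorem tensMat_FOp : tensMat N _ (FOp la mu N M)
    = nestedProd (contrFactor' N (col la mu) fun k => dParam la mu M k + N / 2) (List.finRange _)
      * tensMat N _ (EOp la mu N) := by
  rw [FOp, map_mul, map_list_prod, List.map_map, prod_map_filter, ← prod_pairs]
  congr 2
  refine List.map_congr_left fun p hp => ?_
  have hlt : p.1 < p.2 := by simpa using (List.mem_filter.1 hp).2
  simp only [contrFactor', decide_eq_true_eq]
  split_ifs
  · refine (tensMat_one_sub_smul _ _).trans ?_
    rw [tensMat_Q hlt.ne, contrFactor, dParam, dParam]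
    congr 3
    ring
  · rfl

/-- In finite dimension every matrix element is a continuous functional of the matrix. -/
theorem isFusionValue_of_tendsto {E : Matrix (Fin (size la mu) → Fin N) (Fin (size la mu) → Fin N) ℂ}
    (h : Filter.Tendsto (fun t => nestedProd (swapFactor N fun k => content la mu k + t k)
      (List.finRange _)) (nhdsWithin 0 (fusionDomain la mu)) (nhds E)) :
    IsFusionValue la mu N ((tensMat N _).symm E) := by
  intro w φ
  let ψ : Matrix (Fin (size la mu) → Fin N) (Fin (size la mu) → Fin N) ℂ →ₗ[ℂ] ℂ :=
    φ ∘ₗ (LinearMap.applyₗ w) ∘ₗ (tensMat N (size la mu)).symm.toLinearMap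
  have hψ : Continuous ψ := ψ.continuous_of_finiteDimensional
  refine ((hψ.tendsto E).comp h).congr fun t => ?_
  simp only [Function.comp_apply, ← tensMat_fusionProduct, ψ, LinearMap.comp_apply,
    AlgEquiv.toLinearMap_apply, AlgEquiv.symm_apply_apply, LinearMap.applyₗ_apply_apply]

theorem isFusionValue_EOp (la mu : YoungDiagram) (N : ℕ) :
    IsFusionValue la mu N (EOp la mu N) := by
  have hex : ∃ E, IsFusionValue la mu N E := by
    have hc : ∀ k, Filter.Tendsto (fun t : Fin (size la mu) → ℂ => content la mu k + t k)
        (nhdsWithin 0 (fusionDomain la mu)) (nhds (content la mu k)) := by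
      intro k
      have h1 : Filter.Tendsto (fun t : Fin (size la mu) → ℂ => content la mu k + t k) (nhds 0)
          (nhds (content la mu k + (0 : Fin (size la mu) → ℂ) k)) :=
        ((continuous_const.add (continuous_apply k)).tendsto _)
      rw [Pi.zero_apply, add_zero] at h1
      exact h1.mono_left nhdsWithin_le_nhds
    obtain ⟨E, hE⟩ := exists_tendsto_nestedProd_swapFactor (N := N) (col := col la mu)
      (c := fun (t : Fin (size la mu) → ℂ) k => content la mu k + t k) hc (List.finRange _) (List.nodup_finRange _)
      (colStep_finRange fun k l _ => rfl) diagonalPred_finRange (by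
        filter_upwards [self_mem_nhdsWithin] with t ht
        refine ⟨colStep_finRange fun k l h => ?_, ?_⟩
        · rw [ht.1 k l h]
          ring
        · refine (List.pairwise_lt_finRange _).imp ?_
          intro k l hkl h
          exact ht.2 k l hkl (by linear_combination h))
    exact ⟨_, isFusionValue_of_tendsto hE⟩
  rw [EOp, dif_pos hex]
  exact hex.choose_spec

theorem IsFusionValue.tendsto {E : Module.End ℂ (Tens N (size la mu))}
    (h : IsFusionValue la mu N E) :
    Filter.Tendsto (fun t => nestedProd (swapFactor N fun k => content la mu k + t k)
      (List.finRange _)) (nhdsWithin 0 (fusionDomain la mu)) (nhds (tensMat N _ E)) := by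
  refine tendsto_pi_nhds.2 fun f => tendsto_pi_nhds.2 fun g => ?_
  simp only [← tensMat_fusionProduct, tensMat_apply]
  exact h (tensBasis N _ g) ((tensBasis N _).coord f)

/-! ### Approach to the singular point along a generic line -/

theorem eventually_add_mul_ne_zero {a b : ℂ} (h : a ≠ 0 ∨ b ≠ 0) :
    ∀ᶠ s in nhdsWithin (0 : ℂ) {0}ᶜ, a + s * b ≠ 0 := by
  by_cases ha : a = 0
  · filter_upwards [self_mem_nhdsWithin] with s hs
    rw [ha, zero_add]
    exact mul_ne_zero hs (h.resolve_left (by simpa using ha))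
  · have hc : Continuous fun s : ℂ => a + s * b := by fun_prop
    have h0 : a + 0 * b ≠ 0 := by simpa using ha
    exact (hc.continuousAt.eventually_ne h0).filter_mono nhdsWithin_le_nhds

/-- A line in the space of the constrained variables along which the denominators are generic. -/
def genericLine (la mu : YoungDiagram) (s : ℂ) (k : Fin (size la mu)) : ℂ :=
  s * (col la mu k + 1)

theorem eventually_genericLine_sub_ne_zero {k l : Fin (size la mu)} (h : k < l) :
    ∀ᶠ s in nhdsWithin (0 : ℂ) {0}ᶜ, content la mu k - content la mu l + genericLine la mu s k
      - genericLine la mu s l ≠ 0 := by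
  have h1 : content la mu k - content la mu l ≠ 0 ∨ (col la mu k : ℂ) - col la mu l ≠ 0 := by
    by_cases hcol : col la mu k = col la mu l
    · exact Or.inl (content_sub_content_ne_zero h hcol)
    · right
      rw [sub_ne_zero]
      exact_mod_cast hcol
  filter_upwards [eventually_add_mul_ne_zero h1] with s hs h0
  apply hs
  simp only [genericLine] at h0
  linear_combination h0

theorem eventually_genericLine_add_ne_zero (a : ℂ) (k l : Fin (size la mu)) :
    ∀ᶠ s in nhdsWithin (0 : ℂ) {0}ᶜ, a + genericLine la mu s k + genericLine la mu s l ≠ 0 := by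
  -- The summand 1 in `genericLine` keeps the slope nonzero even for two boxes of column 0.
  have h1 : (col la mu k : ℂ) + col la mu l + 2 ≠ 0 := by
    have : ((col la mu k + col la mu l + 2 : ℕ) : ℂ) ≠ 0 := Nat.cast_ne_zero.2 (by omega)
    exact_mod_cast this
  filter_upwards [eventually_add_mul_ne_zero (a := a) (Or.inr h1)] with s hs h0
  apply hs
  simp only [genericLine] at h0
  linear_combination h0

theorem tendsto_genericLine (k : Fin (size la mu)) :
    Filter.Tendsto (fun s => genericLine la mu s k) (nhdsWithin (0 : ℂ) {0}ᶜ) (nhds 0) := by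
  have hc : Continuous fun s : ℂ => s * ((col la mu k : ℂ) + 1) := by fun_prop
  have := hc.tendsto 0
  rw [zero_mul] at this
  exact this.mono_left nhdsWithin_le_nhds

theorem tendsto_genericLine_fusionDomain :
    Filter.Tendsto (genericLine la mu) (nhdsWithin (0 : ℂ) {0}ᶜ)
      (nhdsWithin 0 (fusionDomain la mu)) := by
  refine tendsto_nhdsWithin_iff.2 ⟨tendsto_pi_nhds.2 tendsto_genericLine, ?_⟩
  have h : ∀ᶠ s in nhdsWithin (0 : ℂ) {0}ᶜ, ∀ k l : Fin (size la mu), k < l →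
      content la mu k - content la mu l + genericLine la mu s k - genericLine la mu s l ≠ 0 :=
    Filter.eventually_all.2 fun k => Filter.eventually_all.2 fun l =>
      Filter.eventually_imp_distrib_left.2 eventually_genericLine_sub_ne_zero
  filter_upwards [h] with s hs
  exact ⟨fun k l hkl => by rw [genericLine, genericLine, hkl], hs⟩

theorem tendsto_nestedProd {X T B : Type*} [Monoid B] [TopologicalSpace B] [ContinuousMul B]
    {F : Filter T} {f : T → X → X → B} {g : X → X → B}
    (h : ∀ k l, Filter.Tendsto (fun t => f t k l) F (nhds (g k l))) :
    ∀ L : List X, Filter.Tendsto (fun t => nestedProd (f t) L) F (nhds (nestedProd g L))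
  | [] => tendsto_const_nhds
  | k :: L => (tendsto_list_prod L fun l _ => h k l).mul (tendsto_nestedProd h L)

open scoped PowerSeries.WithPiTopology

/-- Series converge coefficientwise here, and the coefficients of the resolvent are powers of its
parameter. -/
theorem tendsto_resolvent {T : Type*} {F : Filter T} {d : T → ℂ} {d₀ : ℂ}
    (h : Filter.Tendsto d F (nhds d₀)) :
    Filter.Tendsto (fun t => resolvent (d t)) F (nhds (resolvent d₀)) := by
  rw [PowerSeries.WithPiTopology.tendsto_iff_coeff_tendsto]
  intro a
  rcases a with _ | a
  · simp only [coeff_zero_resolvent]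
    exact tendsto_const_nhds
  · simp only [coeff_succ_resolvent]
    exact h.pow a

theorem tendsto_embed {Y T : Type*} [Fintype Y] [DecidableEq Y] {F : Filter T}
    {A : T → Matrix (Y → Fin N) (Y → Fin N) ℂ} {A₀ : Matrix (Y → Fin N) (Y → Fin N) ℂ}
    (h : Filter.Tendsto A F (nhds A₀)) :
    Filter.Tendsto (fun t => embed Y N (A t)) F (nhds (embed Y N A₀)) := by
  refine tendsto_pi_nhds.2 fun f => tendsto_pi_nhds.2 fun g => ?_
  simp only [embed_apply]
  split_ifs
  · exact (PowerSeries.WithPiTopology.continuous_C.tendsto _).comp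
      (tendsto_pi_nhds.1 (tendsto_pi_nhds.1 h _) _)
  · exact tendsto_const_nhds

theorem tendsto_auxSwap {Y T : Type*} [Fintype Y] [DecidableEq Y] {F : Filter T} {d : T → ℂ} {d₀ : ℂ}
    (h : Filter.Tendsto d F (nhds d₀)) (k : Y) :
    Filter.Tendsto (fun t => auxSwap N (d t) k) F (nhds (auxSwap N d₀ k)) :=
  tendsto_const_nhds.sub ((tendsto_resolvent h).smul_const _)

theorem tendsto_auxContr {Y T : Type*} [Fintype Y] [DecidableEq Y] {F : Filter T} {d : T → ℂ}
    {d₀ : ℂ} (h : Filter.Tendsto d F (nhds d₀)) (k : Y) :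
    Filter.Tendsto (fun t => auxContr N (d t) k) F (nhds (auxContr N d₀ k)) :=
  tendsto_const_nhds.sub ((tendsto_resolvent h.neg).neg.smul_const _)

/-- Off s = 0 the parameters are generic, so the full product G E satisfies the relation and may be
replaced by the reduced one. Only the reduced one has an evident limit at s = 0. -/
theorem embed_FOp_mul (hla : la.colLen 0 + la.colLen 1 ≤ N + M) :
    embed _ N (tensMat N _ (FOp la mu N M)) *
        (((List.finRange _).reverse.map fun k => auxSwap N (dParam la mu M k) k).prod
          * ((List.finRange _).map fun k => auxContr N (dParam la mu M k) k).prod)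
      = ((List.finRange _).reverse.map fun k => auxContr N (dParam la mu M k) k).prod
          * ((List.finRange _).map fun k => auxSwap N (dParam la mu M k) k).prod
        * embed _ N (tensMat N _ (FOp la mu N M)) := by
  have hd : ∀ k, Filter.Tendsto (fun s => dParam la mu M k + genericLine la mu s k)
      (nhdsWithin (0 : ℂ) {0}ᶜ) (nhds (dParam la mu M k)) := fun k => by
    simpa using (tendsto_genericLine k).const_add (dParam la mu M k)
  have hE := (isFusionValue_EOp la mu N).tendsto.comp tendsto_genericLine_fusionDomain
  have hG := tendsto_nestedProd (F := nhdsWithin (0 : ℂ) {0}ᶜ)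
    (f := fun s => contrFactor' N (col la mu)
      fun k => dParam la mu M k + genericLine la mu s k + N / 2)
    (g := contrFactor' N (col la mu) fun k => dParam la mu M k + N / 2)
    (fun k l => by
      unfold contrFactor'
      split_ifs with hcol
      · refine tendsto_const_nhds.sub (Filter.Tendsto.smul_const (Filter.Tendsto.inv₀
          (((hd k).add_const _).add ((hd l).add_const _)) ?_) _)
        -- Since d_k + d_l + N = c_k + c_l + N + M - 1 in terms of contents, the limiting
        -- denominator is the one shown to be nonzero.
        intro h0
        apply content_add_content_ne_zero hla hcol
        simp only [dParam] at h0
        linear_combination h0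
      · exact tendsto_const_nhds) (List.finRange (size la mu))
  have hF := tendsto_embed (hG.mul hE)
  rw [← tensMat_FOp] at hF
  have t1 := tendsto_list_prod (List.finRange (size la mu)) fun k _ => tendsto_auxSwap (N := N) (hd k) k
  have t2 := tendsto_list_prod (List.finRange (size la mu)).reverse
    fun k _ => tendsto_auxSwap (N := N) (hd k) k
  have t3 := tendsto_list_prod (List.finRange (size la mu)) fun k _ => tendsto_auxContr (N := N) (hd k) k
  have t4 := tendsto_list_prod (List.finRange (size la mu)).reverse
    fun k _ => tendsto_auxContr (N := N) (hd k) k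
  -- Both sides of the claim are limits in s of expressions that agree near 0 except at 0.
  refine tendsto_nhds_unique_of_eventuallyEq (hF.mul (t2.mul t3)) ((t4.mul t1).mul hF) ?_
  have h1 : ∀ᶠ s in nhdsWithin (0 : ℂ) {0}ᶜ, ∀ k l : Fin (size la mu), k < l →
      content la mu k - content la mu l + genericLine la mu s k - genericLine la mu s l ≠ 0 :=
    Filter.eventually_all.2 fun k => Filter.eventually_all.2 fun l =>
      Filter.eventually_imp_distrib_left.2 eventually_genericLine_sub_ne_zero
  have h2 : ∀ᶠ s in nhdsWithin (0 : ℂ) {0}ᶜ, ∀ k l : Fin (size la mu),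
      (dParam la mu M k + dParam la mu M l + N) + genericLine la mu s k + genericLine la mu s l ≠ 0 :=
    Filter.eventually_all.2 fun k => Filter.eventually_all.2 fun l =>
      eventually_genericLine_add_ne_zero _ k l
  filter_upwards [h1, h2] with s hs1 hs2
  have hne : ∀ k l, k ≠ l → dParam la mu M k + genericLine la mu s k
      ≠ dParam la mu M l + genericLine la mu s l := by
    intro k l hkl h
    simp only [dParam] at h
    rcases lt_or_gt_of_ne hkl with hlt | hlt
    · exact hs1 k l hlt (by linear_combination h)
    · exact hs1 l k hlt (by linear_combination -h)
  have hadd : ∀ k l, k ≠ l → (dParam la mu M k + genericLine la mu s k + (N : ℂ) / 2)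
      + (dParam la mu M l + genericLine la mu s l + N / 2) ≠ 0 := fun k l _ h =>
    hs2 k l (by linear_combination h)
  have hstep : ∀ a : ℂ, ColStep (col la mu)
      (fun k => dParam la mu M k + genericLine la mu s k + a) (List.finRange _) := fun a =>
    colStep_finRange fun k l hkl => by
      simp only [genericLine, hkl, dParam]
      ring
  have hstep0 : ColStep (col la mu)
      (fun k => dParam la mu M k + genericLine la mu s k) (List.finRange _) := by
    simpa using hstep 0
  have hanti := colAnti_nestedProd_swapFactor (N := N) (List.nodup_finRange _) hstep0
    ((List.nodup_finRange _).imp fun {k l} hkl => hne k l hkl)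
  have hcolsort : (List.finRange (size la mu)).Pairwise fun k l => col la mu k ≤ col la mu l :=
    (List.pairwise_lt_finRange _).imp fun h => col_mono h.le
  have hrem := nestedProd_contrFactor_mul (N := N) hadd (List.nodup_finRange _) (hstep (N / 2))
    hcolsort hanti
  -- E depends only on differences of parameters, from which the shift M/2 - 1/2 drops out.
  have hfus : (swapFactor N fun k => content la mu k + genericLine la mu s k)
      = swapFactor N fun k => dParam la mu M k + genericLine la mu s k := by
    funext k l
    simp only [swapFactor, dParam]
    congr 3
    ring
  have := reflection_intertwining (N := N)
    (d := fun k => dParam la mu M k + genericLine la mu s k)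
    (c := fun k => dParam la mu M k + genericLine la mu s k + N / 2) (fun _ => rfl) hne hadd
    (List.nodup_finRange _)
  rw [hrem] at this
  simpa only [Function.comp_apply, hfus] using this

/-! ### Passage to the twisted Yangian -/

theorem tensMat_twistedGen {n : ℕ} (ρ : Yangian N →ₐ[ℂ] Module.End ℂ (Tens N n)) :
    (fun a i j => tensMat N n (ρ (twistedGen a i j)))
      = mulFamily (fun a i j => (-1 : ℂ) ^ a • tensMat N n (ρ (T a j i)))
          (fun a i j => tensMat N n (ρ (T a i j))) := by
  funext a i j
  simp only [twistedGen, mulFamily, map_sum, map_smul, map_mul, smul_mul_assoc]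

theorem isTwistedIntertwiner_of_twistedGen {V W : Type*} [AddCommGroup V] [Module ℂ V]
    [AddCommGroup W] [Module ℂ W] {ρ : Yangian N →ₐ[ℂ] Module.End ℂ V}
    {θ : Yangian N →ₐ[ℂ] Module.End ℂ W} {F : V →ₗ[ℂ] W}
    (h : ∀ a i j, F ∘ₗ ρ (twistedGen a i j) = θ (twistedGen a i j) ∘ₗ F) :
    IsTwistedIntertwiner ρ θ F := by
  intro y hy
  induction hy using Algebra.adjoin_induction with
  | mem y hy =>
    obtain ⟨a, i, j, rfl⟩ := hy
    exact h a i j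
  | algebraMap r =>
    rw [AlgHom.commutes, AlgHom.commutes]
    ext v
    simp [Module.algebraMap_end_apply]
  | add x y _ _ hx hy =>
    rw [map_add, map_add, LinearMap.comp_add, LinearMap.add_comp, hx, hy]
  | mul x y _ _ hx hy =>
    rw [map_mul, map_mul, Module.End.mul_eq_comp, Module.End.mul_eq_comp, ← LinearMap.comp_assoc,
      hx, LinearMap.comp_assoc, hy, LinearMap.comp_assoc]

theorem isTwistedIntertwiner_FOp (hla : la.colLen 0 + la.colLen 1 ≤ N + M) :
    IsTwistedIntertwiner
      (tensorPowerRep N (size la mu) fun k => twistedEvalRep N (dParam la mu M k))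
      (tensorPowerRep N (size la mu) fun k => evalRep N (dParam la mu M k))
      (FOp la mu N M) := by
  apply isTwistedIntertwiner_of_twistedGen
  have key := embed_FOp_mul (mu := mu) hla
  simp only [auxSwap_eq_siteMat, auxContr_eq_siteMat] at key
  have m1 := monodromy_eq_prod_siteMat (N := N) (fun k => evalRep N (dParam la mu M k))
    (fun k => evalEntry (dParam la mu M k)) fun k => evalRep_T _
  have m2 := monodromy_transpose_eq_prod_siteMat (N := N) (fun k => evalRep N (dParam la mu M k))
    (fun k => evalEntry (dParam la mu M k)) fun k => evalRep_T _
  have m3 := monodromy_eq_prod_siteMat (N := N) (fun k => twistedEvalRep N (dParam la mu M k))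
    (fun k => twistedEntry (dParam la mu M k)) fun k => twistedEvalRep_T _
  have m4 := monodromy_transpose_eq_prod_siteMat (N := N)
    (fun k => twistedEvalRep N (dParam la mu M k))
    (fun k => twistedEntry (dParam la mu M k)) fun k => twistedEvalRep_T _
  simp only [twistedEntry_transpose] at m2
  simp only [evalEntry_transpose] at m4
  -- The reversed swaps are the transposed monodromy of the twisted modules at -x, and the reversed
  -- contractions that of the untwisted ones. Each side thus becomes the generating matrix of the
  -- twisted Yangian composed with F.
  rw [← m4, ← m3, ← m2, ← m1, monodromy_mul, monodromy_mul, ← tensMat_twistedGen,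
    ← tensMat_twistedGen, embed_mul_monodromy, monodromy_mul_embed] at key
  have h := monodromy_injective key
  intro a i j
  apply (tensMat N _).injective
  have := congrFun (congrFun (congrFun h a) i) j
  simp only [← map_mul] at this
  exact this

end Main

end TwistedYangian

end

theorem proposition4 (N M : ℕ) (hN : 0 < N) (la mu : YoungDiagram)
    (hla : la.colLen 0 + la.colLen 1 ≤ N + M) (hmu : mu.colLen 0 + mu.colLen 1 ≤ M) :
    TwistedYangian.IsFusionValue la mu N (TwistedYangian.EOp la mu N) ∧
    TwistedYangian.IsTwistedIntertwiner
      (TwistedYangian.tensorPowerRep N (TwistedYangian.size la mu) fun k =>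
        TwistedYangian.twistedEvalRep N (TwistedYangian.dParam la mu M k))
      (TwistedYangian.tensorPowerRep N (TwistedYangian.size la mu) fun k =>
        TwistedYangian.evalRep N (TwistedYangian.dParam la mu M k))
      (TwistedYangian.FOp la mu N M) :=
  ⟨TwistedYangian.isFusionValue_EOp la mu N, TwistedYangian.isTwistedIntertwiner_FOp hla⟩
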